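/- **Notation.** Let $d\ge 0$ be an integer; $|\cdot|$ is the Euclidean norm on $\mathbf R^d$ and $\mathbf C^d$. For $\alpha\in\mathbf N^d$ put $|\alpha|=\alpha_1+\dots+\alpha_d$ and $\alpha!=\alpha_1!\cdots\alpha_d!$. We write $A\lesssim B$ if $A\le CB$ for some constant $C$ (independent of the variable $\alpha$, respectively $z$). *The Pilipović space.* Let $H=|x|^2-\Delta$ be the harmonic oscillator. $\boldsymbol\Sigma(\mathbf R^d)$ is the space of all $f\in C^\infty(\mathbf R^d)$ such that $$\|f\|_h=\sup_{N\ge 0}\frac{\|H^Nf\|_{L^\infty}}{h^N N!}<\infty\qquad\text{for every } h>0,$$ with the projective limit topology defined by the norms $\|\cdot\|_h$, $h>0$, and $\boldsymbol\Sigma'(\mathbf R^d)$ is its topological dual, with the bilinear pairing $\langle f,g\rangle$. *Hermite series.* Let $$h_\alpha(x)=\pi^{-d/4}(-1)^{|\alpha|}(2^{|\alpha|}\alpha!)^{-1/2}e^{|x|^2/2}\,\partial^\alpha e^{-|x|^2},\qquad \alpha\in\mathbf N^d .$$ $\mathcal H_0'(\mathbf R^d)$ is the space of all formal Hermite series $\sum_\alpha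 c_\alpha h_\alpha$ with arbitrary complex coefficients, and $\mathcal H_\flat(\mathbf R^d)$ is the set of those with $|c_\alpha|\lesssim R^{|\alpha|}(\alpha!)^{-1/2}$ for some $R>0$. A distribution $f\in\boldsymbol\Sigma'(\mathbf R^d)$ is identified with the series with coefficients $c_\alpha(f)=\langle f,h_\alpha\rangle$. *Bargmann transform.* The Bargmann transform of $f=\sum_\alpha c_\alpha h_\alpha\in\mathcal H_0'(\mathbf R^d)$ is the power series $$(\mathfrak V_df)(z)=\sum_{\alpha\in\mathbf N^d}c_\alpha\frac{z^\alpha}{\sqrt{\alpha!}} ,\qquad z\in\mathbf C^d,$$ and $\mathcal A_\flat(\mathbf C^d)$ is the set of all entire functions $F$ on $\mathbf C^d$ with $|F(z)|\lesssim e^{r|z|}$ for some $r>0$. *Modulation spaces.* Let $\phi(x)=\pi^{-d/4}e^{-|x|^2/2}$ and, for $f\in\boldsymbol\Sigma'(\mathbf R^d)$, $$V_\phi f(x,\xi)=(2\pi)^{-d/2}\big\langle f,\overline{\phi(\cdot-x)}\,e^{-i\langle\cdot,\xi\rangle}\big\rangle .$$ A mixed quasi-norm space $\mathscr B$ on $\mathbf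 R^{2d}$ is given by linear subspaces $V_1,\dots,V_n$ with $V_1\oplus\cdots\oplus V_n=\mathbf R^{2d}$ and exponents $p_1,\dots,p_n\in(0,\infty]$; its quasi-norm $\|G\|_{\mathscr B}$ is obtained by taking successively, for $j=1,\dots,n$, the $L^{p_j}(V_j)$ quasi-norm of $G(x_1+\dots+x_n)$ in the variable $x_j\in V_j$. For a positive function $\omega$ on $\mathbf R^{2d}$, $M(\omega,\mathscr B)$ is the set of all $f\in\boldsymbol\Sigma'(\mathbf R^d)$ with $\|V_\phi f\cdot\omega\|_{\mathscr B}<\infty$. For $R>0$ let $$\omega_R(x,\xi)=e^{(|x|^2+|\xi|^2)/4}\,e^{-R(|x|+|\xi|)} .$$ **Theorem.** All functions $h_\alpha$ and $\overline{\phi(\cdot-x)}\,e^{-i\langle\cdot,\xi\rangle}$ belong to $\boldsymbol\Sigma(\mathbf R^d)$, and the power series of $\mathfrak V_df$ converges absolutely at every point of $\mathbf C^d$ when $f\in\boldsymbol\Sigma'(\mathbf R^d)$ or $f\in\mathcal H_\flat(\mathbf R^d)$, so that the objects below are well defined. Let $p\in(0,\infty]$, let $\mathscr B$ be a mixed quasi-norm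 space on $\mathbf R^{2d}$, let $f\in\boldsymbol\Sigma'(\mathbf R^d)$ and let $F=\mathfrak V_df$. Then the following conditions are equivalent: 1. $f\in\mathcal H_\flat(\mathbf R^d)$; 2. $\|F\cdot e^{-R|\cdot|}\|_{L^p(\mathbf C^d)}<\infty$ for some $R>0$; 3. $f\in M(\omega_R,\mathscr B)$ for some $R>0$. Moreover, $\mathfrak V_d$ on $\mathcal H_0'(\mathbf R^d)$ restricts to a bijection from $\mathcal H_\flat(\mathbf R^d)$ to $\mathcal A_\flat(\mathbf C^d)$. -/

import Mathlib

open MeasureTheory Set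
open scoped ENNReal Nat InnerProductSpace

/-- `ℝ^d` with its Euclidean norm. -/
abbrev RSpace (d : ℕ) : Type := EuclideanSpace ℝ (Fin d)

/-- `ℂ^d` with its Euclidean norm. -/
abbrev CSpace (d : ℕ) : Type := EuclideanSpace ℂ (Fin d)

/-- The phase space `ℝ^{2d}`, with points `(x, ξ)`, `x` being the block of coordinates indexed by
`Sum.inl` and `ξ` the block indexed by `Sum.inr`. -/
abbrev PhaseSpace (d : ℕ) : Type := EuclideanSpace ℝ (Fin d ⊕ Fin d)

/-- The position component `x` of `(x, ξ)`. -/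
def PhaseSpace.pos {d : ℕ} (X : PhaseSpace d) : RSpace d :=
  WithLp.toLp 2 (fun j => X (Sum.inl j))

/-- The frequency component `ξ` of `(x, ξ)`. -/
def PhaseSpace.freq {d : ℕ} (X : PhaseSpace d) : RSpace d :=
  WithLp.toLp 2 (fun j => X (Sum.inr j))

/-- `|α| = α₁ + ⋯ + α_d`. -/
def multiLength {d : ℕ} (α : Fin d → ℕ) : ℕ := ∑ j, α j

/-- `α! = α₁! ⋯ α_d!`. -/
def multiFactorial {d : ℕ} (α : Fin d → ℕ) : ℕ := ∏ j, (α j)!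

/-! ### The Pilipović space and its dual -/

/-- The harmonic oscillator `H f = |x|² f - Δ f`. -/
noncomputable def harmonicOscillator {d : ℕ} (f : RSpace d → ℂ) : RSpace d → ℂ :=
  fun x => ((‖x‖ ^ 2 : ℝ) : ℂ) * f x - (Laplacian.laplacian f) x

/-- The powers `H^N f`. -/
noncomputable def harmonicPower {d : ℕ} (N : ℕ) (f : RSpace d → ℂ) : RSpace d → ℂ :=
  harmonicOscillator^[N] f

theorem harmonicOscillator_contDiff {d : ℕ} {f : RSpace d → ℂ} (hf : ContDiff ℝ (⊤ : ℕ∞) f) :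
    ContDiff ℝ (⊤ : ℕ∞) (harmonicOscillator f) := by
  unfold harmonicOscillator
  refine ContDiff.sub (ContDiff.mul ?_ hf) ?_
  · exact Complex.ofRealCLM.contDiff.comp (contDiff_norm_sq (E := RSpace d) ℝ)
  · rw [InnerProductSpace.laplacian_eq_iteratedFDeriv_stdOrthonormalBasis]
    refine ContDiff.sum fun i _ => ?_
    have h : ContDiff ℝ (⊤ : ℕ∞) (iteratedFDeriv ℝ 2 f) :=
      ContDiff.iteratedFDeriv_right hf (by exact_mod_cast le_rfl)
    exact (ContinuousMultilinearMap.apply ℝ (fun _ : Fin 2 => RSpace d) ℂ _).contDiff.comp h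

theorem harmonicPower_contDiff {d : ℕ} {f : RSpace d → ℂ} (hf : ContDiff ℝ (⊤ : ℕ∞) f) (N : ℕ) :
    ContDiff ℝ (⊤ : ℕ∞) (harmonicPower N f) := by
  induction N with
  | zero => exact hf
  | succ N ih =>
    rw [harmonicPower, Function.iterate_succ_apply']
    exact harmonicOscillator_contDiff ih

theorem harmonicPower_add {d : ℕ} {f g : RSpace d → ℂ} (hf : ContDiff ℝ (⊤ : ℕ∞) f)
    (hg : ContDiff ℝ (⊤ : ℕ∞) g) (N : ℕ) :
    harmonicPower N (f + g) = harmonicPower N f + harmonicPower N g := by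
  induction N with
  | zero => rfl
  | succ N ih =>
    have hF := harmonicPower_contDiff hf N
    have hG := harmonicPower_contDiff hg N
    simp only [harmonicPower, Function.iterate_succ_apply'] at *
    rw [ih]
    funext x
    have h2 : (2 : WithTop ℕ∞) ≤ ((⊤ : ℕ∞) : WithTop ℕ∞) := WithTop.coe_le_coe.2 (le_top : (2 : ℕ∞) ≤ ⊤)
    simp only [harmonicOscillator, Pi.add_apply,
      ContDiffAt.laplacian_add (hF.of_le h2).contDiffAt (hG.of_le h2).contDiffAt]
    ring

theorem harmonicPower_smul {d : ℕ} {f : RSpace d → ℂ} (c : ℂ) (hf : ContDiff ℝ (⊤ : ℕ∞) f) (N : ℕ) :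
    harmonicPower N (c • f) = c • harmonicPower N f := by
  induction N with
  | zero => rfl
  | succ N ih =>
    have hF := harmonicPower_contDiff hf N
    simp only [harmonicPower, Function.iterate_succ_apply'] at *
    rw [ih]
    funext x
    have h2 : (2 : WithTop ℕ∞) ≤ ((⊤ : ℕ∞) : WithTop ℕ∞) := WithTop.coe_le_coe.2 (le_top : (2 : ℕ∞) ≤ ⊤)
    simp only [harmonicOscillator, Pi.smul_apply,
      InnerProductSpace.laplacian_smul c (hF.of_le h2).contDiffAt, smul_eq_mul]
    ring

/-- The Pilipović space `𝚺(ℝ^d) = 𝚺_{1/2}(ℝ^d)` as a space of functions: the smooth `f` such that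
`sup_N ‖H^N f‖_∞ / (h^N (N!)^{2s}) < ∞` for every `h > 0`, where `s = 1/2`. -/
def pilipovicFunctions (d : ℕ) : Submodule ℂ (RSpace d → ℂ) where
  carrier := {f | ContDiff ℝ (⊤ : ℕ∞) f ∧
    ∀ h : ℝ, 0 < h → ∃ C : ℝ, ∀ (N : ℕ) (x : RSpace d), ‖harmonicPower N f x‖ ≤ C * (h ^ N * N !)}
  zero_mem' := by
    refine ⟨contDiff_const, fun h _ => ⟨0, fun N x => ?_⟩⟩
    have := harmonicPower_smul (d := d) (f := 0) 0 contDiff_const N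
    rw [zero_smul, zero_smul] at this
    simp [this]
  add_mem' := by
    rintro f g ⟨hf, hf'⟩ ⟨hg, hg'⟩
    refine ⟨hf.add hg, fun h hh => ?_⟩
    obtain ⟨C, hC⟩ := hf' h hh
    obtain ⟨D, hD⟩ := hg' h hh
    refine ⟨C + D, fun N x => ?_⟩
    rw [harmonicPower_add hf hg, Pi.add_apply, add_mul]
    exact (norm_add_le _ _).trans (add_le_add (hC N x) (hD N x))
  smul_mem' := by
    rintro c f ⟨hf, hf'⟩
    refine ⟨contDiff_const.smul hf, fun h hh => ?_⟩
    obtain ⟨C, hC⟩ := hf' h hh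
    refine ⟨‖c‖ * C, fun N x => ?_⟩
    rw [harmonicPower_smul c hf, Pi.smul_apply, norm_smul, mul_assoc]
    exact mul_le_mul_of_nonneg_left (hC N x) (norm_nonneg c)

/-- The Pilipović space `𝚺(ℝ^d)`. It is a type of its own, since its topology (defined below) is
not the topology of pointwise convergence. -/
def PilipovicSpace (d : ℕ) : Type := ↥(pilipovicFunctions d)

instance (d : ℕ) : AddCommGroup (PilipovicSpace d) :=
  inferInstanceAs (AddCommGroup ↥(pilipovicFunctions d))

instance (d : ℕ) : Module ℂ (PilipovicSpace d) :=
  inferInstanceAs (Module ℂ ↥(pilipovicFunctions d))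

/-- The function underlying an element of `𝚺(ℝ^d)`. -/
def PilipovicSpace.toFun {d : ℕ} (f : PilipovicSpace d) : RSpace d → ℂ := f.1

/-- A function with the defining properties, as an element of `𝚺(ℝ^d)`. -/
def PilipovicSpace.ofMem {d : ℕ} (g : RSpace d → ℂ) (hg : g ∈ pilipovicFunctions d) :
    PilipovicSpace d := ⟨g, hg⟩

theorem pilipovicSeminorm_bddAbove {d : ℕ} {h : ℝ} (hh : 0 < h) (f : PilipovicSpace d) :
    BddAbove (range fun q : ℕ × RSpace d => ‖harmonicPower q.1 f.toFun q.2‖ / (h ^ q.1 * q.1 !)) := by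
  obtain ⟨C, hC⟩ := f.2.2 h hh
  refine ⟨C, ?_⟩
  rintro _ ⟨q, rfl⟩
  have : (0 : ℝ) < h ^ q.1 * q.1 ! := by positivity
  exact (div_le_iff₀ this).2 (hC q.1 q.2)

/-- The norms `f ↦ sup_N ‖H^N f‖_∞ / (h^N N!)`, `h > 0`. -/
noncomputable def pilipovicSeminorm (d : ℕ) : SeminormFamily ℂ (PilipovicSpace d) {h : ℝ // 0 < h} :=
  fun h => Seminorm.of
    (fun f => ⨆ q : ℕ × RSpace d, ‖harmonicPower q.1 f.toFun q.2‖ / (h.1 ^ q.1 * q.1 !))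
    (by
      intro f g
      refine ciSup_le fun q => ?_
      have e : (f + g).toFun = f.toFun + g.toFun := rfl
      rw [e, harmonicPower_add (f := f.toFun) (g := g.toFun) f.2.1 g.2.1, Pi.add_apply]
      have hq : (0 : ℝ) ≤ h.1 ^ q.1 * q.1 ! := by have := h.2; positivity
      calc _ ≤ (‖harmonicPower q.1 f.toFun q.2‖ + ‖harmonicPower q.1 g.toFun q.2‖)
              / (h.1 ^ q.1 * q.1 !) := div_le_div_of_nonneg_right (norm_add_le _ _) hq
        _ ≤ _ := by
          rw [add_div]
          exact add_le_add (le_ciSup (pilipovicSeminorm_bddAbove h.2 f) q)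
            (le_ciSup (pilipovicSeminorm_bddAbove h.2 g) q))
    (by
      intro c f
      have e : (c • f).toFun = c • f.toFun := rfl
      rw [e, Real.mul_iSup_of_nonneg (norm_nonneg c)]
      refine iSup_congr fun q => ?_
      rw [harmonicPower_smul (f := f.toFun) c f.2.1, Pi.smul_apply, norm_smul, mul_div_assoc])

instance : Nonempty {h : ℝ // 0 < h} := ⟨⟨1, one_pos⟩⟩

/-- The projective limit topology of `𝚺(ℝ^d)`, generated by the norms with `h > 0`. -/
noncomputable instance (d : ℕ) : TopologicalSpace (PilipovicSpace d) :=
  (pilipovicSeminorm d).moduleFilterBasis.topology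

/-- The Pilipović distribution space `𝚺'(ℝ^d)`: the topological dual of `𝚺(ℝ^d)`. -/
abbrev PilipovicDistribution (d : ℕ) : Type := PilipovicSpace d →L[ℂ] ℂ

open Classical in
/-- The (bilinear) pairing `⟨f, g⟩` of `f ∈ 𝚺'(ℝ^d)` with a function `g`, for `g ∈ 𝚺(ℝ^d)`;
the value `0` given for other functions `g` plays no role. -/
noncomputable def pairing {d : ℕ} (f : PilipovicDistribution d) (g : RSpace d → ℂ) : ℂ :=
  if hg : g ∈ pilipovicFunctions d then f (PilipovicSpace.ofMem g hg) else 0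

/-! ### Hermite series -/

/-- The Hermite function
`h_α(x) = π^{-d/4} (-1)^{|α|} (2^{|α|} α!)^{-1/2} e^{|x|²/2} ∂^α e^{-|x|²}`; here
`∂^α e^{-|x|²}` is the product over `j` of the derivatives of order `α_j` of `t ↦ e^{-t²}` at
`t = x_j`. -/
noncomputable def hermiteFunction {d : ℕ} (α : Fin d → ℕ) : RSpace d → ℂ := fun x =>
  ((Real.pi ^ (-(d : ℝ) / 4) * (-1) ^ multiLength α
    * (Real.sqrt (2 ^ multiLength α * multiFactorial α))⁻¹ * Real.exp (‖x‖ ^ 2 / 2)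
    * ∏ j, iteratedDeriv (α j) (fun t : ℝ => Real.exp (-t ^ 2)) (x j) : ℝ) : ℂ)

/-- The space `𝓗₀'(ℝ^d)` of all formal Hermite series `∑_α c_α h_α`, each of them represented by
its family of coefficients. -/
abbrev FormalHermiteSeries (d : ℕ) : Type := (Fin d → ℕ) → ℂ

/-- The Hermite series of `f ∈ 𝚺'(ℝ^d)`, whose coefficients are `c_α(f) = (f, h_α)_{L²}`, that is
`⟨f, h_α⟩`, as `h_α` is real-valued. -/
noncomputable def hermiteSeries {d : ℕ} (f : PilipovicDistribution d) : FormalHermiteSeries d :=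
  fun α => pairing f (hermiteFunction α)

/-- The space `𝓗_♭(ℝ^d)`: the Hermite series with `|c_α| ≲ R^{|α|} (α!)^{-1/2}` for some
`R > 0`. -/
def HFlat (d : ℕ) : Set (FormalHermiteSeries d) :=
  {c | ∃ R : ℝ, 0 < R ∧ ∃ C : ℝ, ∀ α : Fin d → ℕ,
    ‖c α‖ ≤ C * (R ^ multiLength α / Real.sqrt (multiFactorial α))}

/-! ### The Bargmann transform -/

/-- The monomial `e_α(z) = z^α / √(α!)`. -/
noncomputable def monomialE {d : ℕ} (α : Fin d → ℕ) (z : CSpace d) : ℂ :=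
  (∏ j, z j ^ α j) / (Real.sqrt (multiFactorial α) : ℂ)

/-- The Bargmann transform of the formal Hermite series `∑_α c_α h_α`: the sum of the power series
`∑_α c_α e_α(z)`. -/
noncomputable def bargmannTransform {d : ℕ} (c : FormalHermiteSeries d) : CSpace d → ℂ :=
  fun z => ∑' α, c α * monomialE α z

/-- The space `𝓐_♭(ℂ^d)`: the entire functions `F` with `|F(z)| ≲ e^{r|z|}` for some `r > 0`. -/
def AFlat (d : ℕ) : Set (CSpace d → ℂ) :=
  {F | Differentiable ℂ F ∧ ∃ r : ℝ, 0 < r ∧ ∃ C : ℝ, ∀ z, ‖F z‖ ≤ C * Real.exp (r * ‖z‖)}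

/-! ### Short-time Fourier transform and modulation spaces -/

/-- The Gaussian `φ(x) = π^{-d/4} e^{-|x|²/2}`. -/
noncomputable def gaussianWindow {d : ℕ} (x : RSpace d) : ℂ :=
  ((Real.pi ^ (-(d : ℝ) / 4) * Real.exp (-‖x‖ ^ 2 / 2) : ℝ) : ℂ)

/-- The function `y ↦ conj (φ(y - x)) e^{-i⟨y, ξ⟩}`. -/
noncomputable def stftAtom {d : ℕ} (x ξ : RSpace d) : RSpace d → ℂ := fun y =>
  (starRingEnd ℂ) (gaussianWindow (y - x)) * Complex.exp (-Complex.I * (⟪y, ξ⟫_ℝ : ℂ))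

/-- The short-time Fourier transform
`V_φ f(x, ξ) = (2π)^{-d/2} ⟨f, conj (φ(· - x)) e^{-i⟨·, ξ⟩}⟩` of `f ∈ 𝚺'(ℝ^d)`. -/
noncomputable def stft {d : ℕ} (f : PilipovicDistribution d) (x ξ : RSpace d) : ℂ :=
  (((2 * Real.pi) ^ (-(d : ℝ) / 2) : ℝ) : ℂ) * pairing f (stftAtom x ξ)

/-- The data of a mixed quasi-norm space on `E`: subspaces `V₁, …, V_n` with
`V₁ ⊕ ⋯ ⊕ V_n = E` and exponents `p₁, …, p_n ∈ (0, ∞]`. -/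
structure MixedQuasiNormSpace (E : Type) [NormedAddCommGroup E] [InnerProductSpace ℝ E] where
  /-- the number of factors -/
  n : ℕ
  /-- the exponents -/
  p : Fin n → ℝ≥0∞
  /-- the subspaces -/
  V : Fin n → Submodule ℝ E
  p_pos : ∀ j, 0 < p j
  isInternal : DirectSum.IsInternal V

/-- The iterated norm: the `L^{p₁}(V₁)` norm is taken first (in the first variable, the other ones
being fixed), then the `L^{p₂}(V₂)` norm, and so on, with respect to Lebesgue measures. -/
noncomputable def iteratedLpNorm {E : Type} [NormedAddCommGroup E] [InnerProductSpace ℝ E]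
    [FiniteDimensional ℝ E] [MeasurableSpace E] [BorelSpace E] :
    (n : ℕ) → (Fin n → ℝ≥0∞) → (V : Fin n → Submodule ℝ E) → ((∀ j, V j) → ℝ≥0∞) → ℝ≥0∞
  | 0, _, _, G => G (fun j => j.elim0)
  | n + 1, p, V, G =>
    iteratedLpNorm n (fun j => p j.succ) (fun j => V j.succ) fun y =>
      eLpNorm (fun x : V 0 => G (Fin.cons (α := fun j => V j) x y)) (p 0) volume

/-- The quasi-norm `‖G‖_𝓑`, with `G(x₁ + ⋯ + x_n)` viewed as a function of `x_j ∈ V_j`. -/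
noncomputable def MixedQuasiNormSpace.quasiNorm {E : Type} [NormedAddCommGroup E]
    [InnerProductSpace ℝ E] [FiniteDimensional ℝ E] [MeasurableSpace E] [BorelSpace E]
    (𝓑 : MixedQuasiNormSpace E) (G : E → ℂ) : ℝ≥0∞ :=
  iteratedLpNorm 𝓑.n 𝓑.p 𝓑.V fun x => ‖G (∑ j, (x j : E))‖ₑ

/-- The modulation space `M(ω, 𝓑) = {f ∈ 𝚺'(ℝ^d) : ‖V_φ f · ω‖_𝓑 < ∞}`. -/
def modulationSpace {d : ℕ} (ω : PhaseSpace d → ℝ) (𝓑 : MixedQuasiNormSpace (PhaseSpace d)) :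
    Set (PilipovicDistribution d) :=
  {f | 𝓑.quasiNorm (fun X => stft f X.pos X.freq * (ω X : ℂ)) < ∞}

/-- The weight `ω_R(x, ξ) = e^{(|x|² + |ξ|²)/4} e^{-R(|x| + |ξ|)}`. -/
noncomputable def weightOmega {d : ℕ} (R : ℝ) (X : PhaseSpace d) : ℝ :=
  Real.exp ((‖X.pos‖ ^ 2 + ‖X.freq‖ ^ 2) / 4) * Real.exp (-R * (‖X.pos‖ + ‖X.freq‖))

/-! Everything reduces to one question: is the entire function F = 𝔙_d f of exponential type?

On the coefficient side this is Cauchy's theory. The bound |c_α| ≲ R^{|α|}/√(α!) says that the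
Taylor coefficients c_α/√(α!) of F are dominated by those of a product of exponentials. Conversely,
Cauchy estimates on circles of radius n + 1, taken one variable at a time, return coefficients of
this size (`exists_hasSum_of_exponential_type`). With uniqueness of power series this gives the
bijection.

The short-time Fourier transform enters through the generating function ∑ e_α(w) h_α. Its value at w
= (x - iξ)/√2 is a scalar multiple of the shifted window. The series converges in 𝚺: H multiplies
h_α by 2|α| + d and h_α grows at most exponentially in |α|, while e_α(w) decays like 1/√(α!). A
distribution may therefore be applied term by term (`pairing_gaussianAtom`), and |V_φ f| equals a
constant times e^{-(|x|²+|ξ|²)/4} |F(w)|. So condition 3, like condition 2, is an exponentially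
weighted quasi-norm bound on F.

Exponential type makes all such quasi-norms finite for large R. For the converse, finiteness is used
only in this form: if |F| ≥ t on the ball of radius ε ≤ 1 about z, then t ε^N ≤ K e^{R|z|}. This
holds for any exponents and any order of integration, and needs no measurability of the iterated
norms. Continuity of f on 𝚺 supplies the a priori bound log|F(z)| ≤ C(1+|z|)². Now suppose log|F(z)|
≤ m(|z|) with m increasing, and put M = m(|z|+2). By Cauchy, F is e^M-Lipschitz on the unit ball
about z, so |F| ≥ |F(z)|/2 on the ball of radius |F(z)|/(2e^M). Inserting this ball gives log|F(z)|
≤ a + b|z| + θ m(|z|+2) with θ = N/(1+N) < 1. Iteration contracts the quadratic term to zero and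
leaves a linear bound (`exists_exponential_type_of_small_ball_estimate`). -/

/-! ### Series over multi-indices and convergence of the Bargmann series. -/

theorem summable_norm_prod_multiIndex {𝕜 : Type*} [RCLike 𝕜] :
    ∀ {d : ℕ} {f : Fin d → ℕ → 𝕜}, (∀ j, Summable fun n => ‖f j n‖) →
      Summable fun α : Fin d → ℕ => ‖∏ j, f j (α j)‖
  | 0, f, _ => Summable.of_finite
  | d + 1, f, hf => by
    have ih := summable_norm_prod_multiIndex (d := d) (f := fun j => f j.succ) fun j => hf j.succ
    rw [← (Fin.consEquiv fun _ : Fin (d + 1) => ℕ).summable_iff]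
    refine ((hf 0).mul_norm ih).congr fun x => ?_
    simp [Fin.consEquiv, Fin.prod_univ_succ]

theorem tsum_prod_multiIndex {𝕜 : Type*} [RCLike 𝕜] :
    ∀ {d : ℕ} {f : Fin d → ℕ → 𝕜}, (∀ j, Summable fun n => ‖f j n‖) →
      ∑' α : Fin d → ℕ, ∏ j, f j (α j) = ∏ j, ∑' n, f j n
  | 0, f, _ => by simp
  | d + 1, f, hf => by
    have ih := tsum_prod_multiIndex (d := d) (f := fun j => f j.succ) fun j => hf j.succ
    have hs := summable_norm_prod_multiIndex (f := fun j => f j.succ) fun j => hf j.succ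
    rw [← (Fin.consEquiv fun _ : Fin (d + 1) => ℕ).tsum_eq, Fin.prod_univ_succ, ← ih,
      tsum_mul_tsum_of_summable_norm (hf 0) hs]
    refine tsum_congr fun x => ?_
    simp [Fin.consEquiv, Fin.prod_univ_succ]

theorem hasSum_prod_multiIndex {𝕜 : Type*} [RCLike 𝕜] {d : ℕ} {f : Fin d → ℕ → 𝕜} {s : Fin d → 𝕜}
    (hf : ∀ j, Summable fun n => ‖f j n‖) (hs : ∀ j, HasSum (f j) (s j)) :
    HasSum (fun α : Fin d → ℕ => ∏ j, f j (α j)) (∏ j, s j) := by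
  have h := (summable_norm_prod_multiIndex hf).of_norm.hasSum
  rwa [tsum_prod_multiIndex hf, Finset.prod_congr rfl fun j _ => (hs j).tsum_eq] at h

theorem pow_multiLength {M : Type*} [CommMonoid M] {d : ℕ} (a : M) (α : Fin d → ℕ) :
    a ^ multiLength α = ∏ j, a ^ α j :=
  (Finset.prod_pow_eq_pow_sum _ _ _).symm

theorem sqrt_multiFactorial {d : ℕ} (α : Fin d → ℕ) :
    √(multiFactorial α : ℝ) = ∏ j, √((α j)! : ℝ) := by
  rw [multiFactorial, Nat.cast_prod, Real.sqrt_prod _ fun _ _ => by positivity]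

theorem multiFactorial_pos {d : ℕ} (α : Fin d → ℕ) : 0 < multiFactorial α :=
  Finset.prod_pos fun _ _ => Nat.factorial_pos _

theorem pow_div_sqrt_factorial_le (t : ℝ) (n : ℕ) : |t| ^ n / √(n ! : ℝ) ≤ Real.exp (t ^ 2) := by
  have h := Real.pow_div_factorial_le_exp (x := t ^ 2) (sq_nonneg t) n
  have h1 : (|t| ^ n / √(n ! : ℝ)) ^ 2 ≤ Real.exp (t ^ 2) := by
    rw [div_pow, Real.sq_sqrt (by positivity), ← pow_mul, mul_comm, pow_mul, sq_abs]
    exact h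
  have h2 : 1 ≤ Real.exp (t ^ 2) := Real.one_le_exp (sq_nonneg t)
  nlinarith [show 0 ≤ |t| ^ n / √(n ! : ℝ) by positivity]

/-- The previous bound at 2t leaves a spare factor 2^{-n}, which makes the sum converge. The
Gaussian constant is what later gives F order two. -/
theorem pow_div_sqrt_factorial_le_geometric (t : ℝ) (n : ℕ) :
    |t| ^ n / √(n ! : ℝ) ≤ Real.exp ((2 * t) ^ 2) * (1 / 2) ^ n := by
  have h := pow_div_sqrt_factorial_le (2 * t) n
  calc |t| ^ n / √(n ! : ℝ) = |2 * t| ^ n / √(n ! : ℝ) * (1 / 2) ^ n := by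
        rw [abs_mul, mul_pow, abs_two, one_div, inv_pow]; field_simp
    _ ≤ _ := by gcongr

theorem summable_pow_div_sqrt_factorial (t : ℝ) : Summable fun n : ℕ => t ^ n / √(n ! : ℝ) := by
  refine .of_norm_bounded (summable_geometric_two.mul_left (Real.exp ((2 * t) ^ 2))) fun n => ?_
  rw [norm_div, norm_pow, Real.norm_eq_abs, Real.norm_of_nonneg (Real.sqrt_nonneg _)]
  exact pow_div_sqrt_factorial_le_geometric t n

theorem summable_pow_multiLength_div_sqrt {d : ℕ} (t : ℝ) :
    Summable fun α : Fin d → ℕ => t ^ multiLength α / √(multiFactorial α : ℝ) := by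
  have h := (summable_norm_prod_multiIndex (d := d) (f := fun _ n => t ^ n / √(n ! : ℝ))
    fun _ => (summable_pow_div_sqrt_factorial t).norm).of_norm
  refine h.congr fun α => ?_
  rw [pow_multiLength, sqrt_multiFactorial, Finset.prod_div_distrib]

theorem norm_monomialE {d : ℕ} (α : Fin d → ℕ) (z : CSpace d) :
    ‖monomialE α z‖ = (∏ j, ‖z j‖ ^ α j) / √(multiFactorial α : ℝ) := by
  simp [monomialE, abs_of_nonneg (Real.sqrt_nonneg _)]

theorem norm_monomialE_le {d : ℕ} (α : Fin d → ℕ) {z : CSpace d} {ρ : ℝ} (hz : ‖z‖ ≤ ρ) :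
    ‖monomialE α z‖ ≤ ρ ^ multiLength α / √(multiFactorial α : ℝ) := by
  rw [norm_monomialE, pow_multiLength]
  gcongr with j
  exact (PiLp.norm_apply_le z j).trans hz

theorem tsum_pow_multiLength_div_sqrt_le {d : ℕ} {t : ℝ} (ht : 0 ≤ t) :
    ∑' α : Fin d → ℕ, t ^ multiLength α / √(multiFactorial α : ℝ) ≤
      (2 * Real.exp ((2 * t) ^ 2)) ^ d := by
  have h := tsum_prod_multiIndex (d := d) (f := fun _ n => t ^ n / √(n ! : ℝ))
    fun _ => (summable_pow_div_sqrt_factorial t).norm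
  simp_rw [Finset.prod_div_distrib, ← pow_multiLength, ← sqrt_multiFactorial] at h
  rw [h, Finset.prod_const, Finset.card_univ, Fintype.card_fin]
  refine pow_le_pow_left₀ (tsum_nonneg fun n => by positivity) ?_ d
  calc ∑' n : ℕ, t ^ n / √(n ! : ℝ) ≤ ∑' n : ℕ, Real.exp ((2 * t) ^ 2) * (1 / 2) ^ n :=
        (summable_pow_div_sqrt_factorial t).tsum_le_tsum
          (fun n => by simpa only [abs_of_nonneg ht] using pow_div_sqrt_factorial_le_geometric t n)
          (summable_geometric_two.mul_left _)
    _ = _ := by rw [tsum_mul_left, tsum_geometric_two, mul_comm]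

/-- Coefficients of at most exponential growth: the power series converges absolutely. -/
theorem summable_norm_mul_monomialE {d : ℕ} {c : FormalHermiteSeries d} {C A : ℝ}
    (hc : ∀ α, ‖c α‖ ≤ C * A ^ multiLength α) (z : CSpace d) :
    Summable fun α => ‖c α * monomialE α z‖ := by
  refine Summable.of_nonneg_of_le (fun _ => norm_nonneg _) (fun α => ?_)
    ((summable_pow_multiLength_div_sqrt (d := d) (A * ‖z‖)).mul_left C)
  rw [norm_mul, mul_pow, mul_div_assoc, ← mul_assoc]
  exact mul_le_mul (hc α) (norm_monomialE_le α le_rfl) (norm_nonneg _) ((norm_nonneg _).trans (hc α))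

theorem norm_bargmannTransform_le {d : ℕ} {c : FormalHermiteSeries d} {C A : ℝ} (hC : 0 ≤ C)
    (hA : 0 ≤ A) (hc : ∀ α, ‖c α‖ ≤ C * A ^ multiLength α) (z : CSpace d) :
    ‖bargmannTransform c z‖ ≤ C * (2 * Real.exp ((2 * (A * ‖z‖)) ^ 2)) ^ d := by
  refine (norm_tsum_le_tsum_norm (summable_norm_mul_monomialE hc z)).trans ?_
  calc ∑' α, ‖c α * monomialE α z‖
      ≤ ∑' α : Fin d → ℕ, C * ((A * ‖z‖) ^ multiLength α / √(multiFactorial α : ℝ)) := by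
        refine (summable_norm_mul_monomialE hc z).tsum_le_tsum (fun α => ?_)
          ((summable_pow_multiLength_div_sqrt (d := d) (A * ‖z‖)).mul_left C)
        rw [norm_mul, mul_pow, mul_div_assoc, ← mul_assoc]
        exact mul_le_mul (hc α) (norm_monomialE_le α le_rfl) (norm_nonneg _)
          ((norm_nonneg _).trans (hc α))
    _ ≤ _ := by
        rw [tsum_mul_left]
        exact mul_le_mul_of_nonneg_left (tsum_pow_multiLength_div_sqrt_le (by positivity)) hC

/-! ### Cauchy estimates and Taylor expansion in several variables. -/

/-- Cauchy's estimate for the Fréchet derivative on the unit ball. -/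
theorem norm_fderiv_le_of_norm_le_on_closedBall {E : Type*} [NormedAddCommGroup E]
    [NormedSpace ℂ E] {F : E → ℂ} (hF : Differentiable ℂ F) {z : E} {M : ℝ}
    (hM : ∀ w, ‖w - z‖ ≤ 1 → ‖F w‖ ≤ M) : ‖fderiv ℂ F z‖ ≤ M := by
  have hM0 : 0 ≤ M := (norm_nonneg _).trans (hM z (by simp))
  refine ContinuousLinearMap.opNorm_le_bound _ hM0 fun v => ?_
  rcases eq_or_ne v 0 with rfl | hv
  · simp
  have hv' : 0 < ‖v‖ := norm_pos_iff.2 hv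
  have hline : ∀ t : ℂ, HasDerivAt (fun t : ℂ => z + t • v) v t := fun t => by
    simpa using ((hasDerivAt_id t).smul_const v).const_add z
  have hd : HasDerivAt (fun t : ℂ => F (z + t • v)) (fderiv ℂ F z v) 0 := by
    have h := (hF (z + (0 : ℂ) • v)).hasFDerivAt.comp_hasDerivAt (0 : ℂ) (hline 0)
    simpa [Function.comp_def] using! h
  have hdiff : Differentiable ℂ fun t : ℂ => F (z + t • v) :=
    hF.comp fun t => (hline t).differentiableAt
  -- The circle of radius 1/‖v‖ in the parameter is exactly the unit circle about z in the direction
  -- v.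
  have h := Complex.norm_deriv_le_of_forall_mem_sphere_norm_le (c := 0) (R := 1 / ‖v‖) (C := M)
    (by positivity) hdiff.diffContOnCl fun t ht => hM _ ?_
  · rw [hd.deriv] at h
    simpa using h
  · rw [mem_sphere_zero_iff_norm] at ht
    rw [add_sub_cancel_left, norm_smul, ht]
    field_simp; rfl

/-- Up to a constant the integral is a Taylor coefficient of F in its first variable, so this is
what lets the induction on the dimension continue in the remaining variables. The proof
differentiates under the integral; the dominating constant comes from Cauchy's estimate and the
local boundedness of F. -/
theorem differentiable_circleIntegral_cons {d : ℕ} {F : (Fin (d + 1) → ℂ) → ℂ}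
    (hF : Differentiable ℂ F) (hb : ∀ ρ : ℝ, ∃ M, ∀ w, ‖w‖ ≤ ρ → ‖F w‖ ≤ M) (n : ℕ) :
    Differentiable ℂ fun x : Fin d → ℂ =>
      ∮ ζ in C(0, 1), (1 / (ζ - 0) ^ (n + 1)) • F (Fin.cons (α := fun _ => ℂ) ζ x) := by
  intro x₀
  obtain ⟨M, hM⟩ := hb (‖x₀‖ + 3)
  let ι : (Fin d → ℂ) →L[ℂ] (Fin (d + 1) → ℂ) :=
    ContinuousLinearMap.finCons 0 (ContinuousLinearMap.id ℂ (Fin d → ℂ))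
  have hcons : ∀ (ζ : ℂ) (x : Fin d → ℂ),
      HasFDerivAt (fun x : Fin d → ℂ => (Fin.cons ζ x : Fin (d + 1) → ℂ)) ι x := fun ζ x =>
    HasFDerivAtFilter.finCons (F' := fun _ => ℂ) (hasFDerivAt_const ζ x) (hasFDerivAt_id x)
  have hcomp : ∀ (ζ : ℂ) (x : Fin d → ℂ),
      HasFDerivAt (fun x : Fin d → ℂ => F (Fin.cons ζ x))
        (fderiv ℂ F (Fin.cons (α := fun _ => ℂ) ζ x) ∘L ι) x := fun ζ x =>
    (hF _).hasFDerivAt.comp x (hcons ζ x)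
  have hcm : ∀ x : Fin d → ℂ,
      Continuous fun θ : ℝ => (Fin.cons (circleMap 0 1 θ) x : Fin (d + 1) → ℂ) := fun x => by
    refine continuous_pi fun j => ?_
    refine Fin.cases ?_ (fun i => ?_) j
    · simpa using continuous_circleMap 0 1
    · simpa using continuous_const
  have hk : Continuous fun θ : ℝ => deriv (circleMap 0 1) θ * (1 / (circleMap 0 1 θ - 0) ^ (n + 1)) := by
    simp only [deriv_circleMap, sub_zero]
    refine (by fun_prop : Continuous fun θ : ℝ => circleMap 0 1 θ * Complex.I).mul
      (continuous_const.div ((continuous_circleMap 0 1).pow _) fun θ => ?_)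
    exact pow_ne_zero _ (circleMap_ne_center one_ne_zero)
  have hknorm : ∀ θ : ℝ,
      ‖deriv (circleMap 0 1) θ * (1 / (circleMap 0 1 θ - 0) ^ (n + 1))‖ = 1 := fun θ => by
    simp [deriv_circleMap]
  have hcont : ∀ x : Fin d → ℂ, Continuous fun θ : ℝ =>
      (deriv (circleMap 0 1) θ * (1 / (circleMap 0 1 θ - 0) ^ (n + 1))) *
        F (Fin.cons (α := fun _ => ℂ) (circleMap 0 1 θ) x) :=
    fun x => hk.mul (hF.continuous.comp (hcm x))
  have hmeas : AEStronglyMeasurable (fun θ : ℝ =>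
      (deriv (circleMap 0 1) θ * (1 / (circleMap 0 1 θ - 0) ^ (n + 1))) •
        (fderiv ℂ F (Fin.cons (α := fun _ => ℂ) (circleMap 0 1 θ) x₀) ∘L ι))
      (volume.restrict (Set.uIoc 0 (2 * Real.pi))) := by
    have : SecondCountableTopology ((Fin (d + 1) → ℂ) →L[ℂ] ℂ) := by
      have := FiniteDimensional.proper ℂ ((Fin (d + 1) → ℂ) →L[ℂ] ℂ)
      infer_instance
    have h1 : StronglyMeasurable fun θ : ℝ =>
        fderiv ℂ F (Fin.cons (α := fun _ => ℂ) (circleMap 0 1 θ) x₀) :=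
      ((measurable_fderiv ℂ F).comp (hcm x₀).measurable).stronglyMeasurable
    have h2 := ((ContinuousLinearMap.compL ℂ (Fin d → ℂ) (Fin (d + 1) → ℂ) ℂ).flip
      ι).continuous.comp_stronglyMeasurable h1
    exact (hk.stronglyMeasurable.smul h2).aestronglyMeasurable
  have key := intervalIntegral.hasFDerivAt_integral_of_dominated_of_fderiv_le (𝕜 := ℂ) (μ := volume)
    (a := 0) (b := 2 * Real.pi) (x₀ := x₀) (s := Metric.ball x₀ 1)
    (bound := fun _ => M * ‖ι‖) (Metric.ball_mem_nhds x₀ one_pos)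
    (Filter.Eventually.of_forall fun x => (hcont x).aestronglyMeasurable)
    ((hcont x₀).intervalIntegrable _ _) hmeas
    (Filter.Eventually.of_forall fun θ _ x hx => ?_) intervalIntegrable_const
    (Filter.Eventually.of_forall fun θ _ x _ => (hcomp (circleMap 0 1 θ) x).const_mul _)
  · refine (key.differentiableAt).congr_of_eventuallyEq (Filter.Eventually.of_forall fun x => ?_)
    simp only [circleIntegral, smul_eq_mul, mul_assoc]
  · have hx' : ‖x‖ ≤ ‖x₀‖ + 1 := by
      have := norm_sub_norm_le x x₀
      rw [Metric.mem_ball, dist_eq_norm] at hx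
      linarith
    have hnorm : ‖(Fin.cons (circleMap 0 1 θ) x : Fin (d + 1) → ℂ)‖ ≤ ‖x₀‖ + 2 := by
      rw [pi_norm_le_iff_of_nonneg (by positivity)]
      refine Fin.cases ?_ fun i => ?_
      · simp only [Fin.cons_zero, norm_circleMap_zero, abs_one]
        linarith [norm_nonneg x₀]
      · rw [Fin.cons_succ]
        linarith [norm_le_pi_norm x i]
    rw [norm_smul, hknorm, one_mul]
    refine (ContinuousLinearMap.opNorm_comp_le _ _).trans
      (mul_le_mul_of_nonneg_right ?_ (norm_nonneg _))
    refine norm_fderiv_le_of_norm_le_on_closedBall hF fun w hw => hM w ?_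
    have := norm_sub_norm_le w (Fin.cons (circleMap 0 1 θ) x : Fin (d + 1) → ℂ)
    linarith

/-- Taylor expansion of an entire function of exponential type, with estimates for the
coefficients. -/
theorem exists_hasSum_of_exponential_type : ∀ {d : ℕ} {F : (Fin d → ℂ) → ℂ} {C r : ℝ},
    Differentiable ℂ F → 0 ≤ r → (∀ z, ‖F z‖ ≤ C * Real.exp (r * ∑ j, ‖z j‖)) →
    ∃ b : (Fin d → ℕ) → ℂ,
      (∀ α, ‖b α‖ ≤ C * Real.exp r ^ d * ∏ j, Real.exp r ^ α j / ((α j)! : ℝ)) ∧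
      ∀ z, HasSum (fun α => b α * ∏ j, z j ^ α j) (F z)
  | 0, F, C, r, _, _, hb => by
    refine ⟨fun _ => F 0, fun α => by simpa using hb 0, fun z => ?_⟩
    rw [Subsingleton.elim z 0]
    convert! hasSum_unique (fun α : Fin 0 → ℕ => F 0 * ∏ j, (0 : Fin 0 → ℂ) j ^ α j)
    simp
  | d + 1, F, C, r, hF, hr, hb => by
    have hC : 0 ≤ C := by
      have := (norm_nonneg _).trans (hb 0)
      exact nonneg_of_mul_nonneg_left this (Real.exp_pos _)
    have hline : ∀ x : Fin d → ℂ, Differentiable ℂ fun ζ : ℂ => F (Fin.cons (α := fun _ => ℂ) ζ x) := by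
      intro x
      refine hF.comp (differentiable_pi.2 fun j => ?_)
      refine Fin.cases ?_ (fun i => ?_) j
      · simp
      · simp
    let a : ℕ → (Fin d → ℂ) → ℂ := fun n x =>
      (n ! : ℂ)⁻¹ * iteratedDeriv n (fun ζ : ℂ => F (Fin.cons (α := fun _ => ℂ) ζ x)) 0
    have ha_diff : ∀ n, Differentiable ℂ (a n) := by
      intro n
      have hloc : ∀ ρ : ℝ, ∃ M, ∀ w, ‖w‖ ≤ ρ → ‖F w‖ ≤ M := fun ρ =>
        ⟨C * Real.exp (r * ∑ _j : Fin (d + 1), ρ), fun w hw => (hb w).trans (by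
          gcongr with j
          exact (norm_le_pi_norm w j).trans hw)⟩
      have h := (differentiable_circleIntegral_cons hF hloc n).const_mul
        ((n ! : ℂ)⁻¹ * (2 * Real.pi * Complex.I / n !)⁻¹)
      refine (funext fun x => ?_ : a n = _) ▸ h
      have hq := (hline x).diffContOnCl.circleIntegral_one_div_sub_center_pow_smul (c := 0)
        (R := 1) one_pos n
      rw [hq]
      have h2 : (2 * (Real.pi : ℂ) * Complex.I / n !) ≠ 0 := by simp [Nat.factorial_ne_zero]
      simp only [a, smul_eq_mul]
      field_simp
    have ha_bound : ∀ n x, ‖a n x‖ ≤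
        (C * Real.exp r * (Real.exp r ^ n / (n ! : ℝ))) * Real.exp (r * ∑ j, ‖x j‖) := by
      intro n x
      -- Radius n would balance e^{rR} against R^{-n}; n + 1 stays positive at n = 0 and costs one
      -- factor e^r per variable. Because the growth is measured by ∑ ‖z j‖, the dependence on the
      -- other variables splits off and the induction hypothesis applies.
      have h := Complex.norm_iteratedDeriv_le_of_forall_mem_sphere_norm_le (c := 0) (R := n + 1)
        (C := C * Real.exp (r * (n + 1)) * Real.exp (r * ∑ j, ‖x j‖)) n (by positivity)
        (hline x).diffContOnCl fun ζ hζ => by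
          rw [mem_sphere_zero_iff_norm] at hζ
          refine (hb _).trans (le_of_eq ?_)
          rw [Fin.sum_univ_succ, mul_add, Real.exp_add]
          simp [hζ, mul_assoc]
      have hfac : (n ! : ℝ) ≤ (n + 1 : ℝ) ^ n := by
        have h1 : (n ! : ℝ) ≤ (n : ℝ) ^ n := by exact_mod_cast Nat.factorial_le_pow n
        exact h1.trans (by gcongr; linarith)
      calc ‖a n x‖ = (n ! : ℝ)⁻¹ * ‖iteratedDeriv n
            (fun ζ : ℂ => F (Fin.cons (α := fun _ => ℂ) ζ x)) 0‖ := by simp [a]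
        _ ≤ (n ! : ℝ)⁻¹ * ((n ! : ℝ) * (C * Real.exp (r * (n + 1)) *
              Real.exp (r * ∑ j, ‖x j‖)) / (n + 1 : ℝ) ^ n) := by gcongr
        _ = C * Real.exp (r * (n + 1)) * Real.exp (r * ∑ j, ‖x j‖) / (n + 1 : ℝ) ^ n := by
            field_simp
        _ ≤ C * Real.exp (r * (n + 1)) * Real.exp (r * ∑ j, ‖x j‖) / (n ! : ℝ) := by gcongr
        _ = _ := by
            rw [mul_add, mul_one, Real.exp_add, mul_comm r (n : ℝ), Real.exp_nat_mul]; ring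
    choose b hb1 hb2 using fun n =>
      exists_hasSum_of_exponential_type (ha_diff n) hr (ha_bound n)
    refine ⟨fun α => b (α 0) (Fin.tail α), fun α => ?_, fun z => ?_⟩
    · refine (hb1 _ _).trans (le_of_eq ?_)
      rw [Fin.prod_univ_succ, pow_succ]
      simp only [Fin.tail]
      ring
    · have hsum : Summable fun α : Fin (d + 1) → ℕ => b (α 0) (Fin.tail α) * ∏ j, z j ^ α j := by
        refine Summable.of_norm_bounded (g := fun α : Fin (d + 1) → ℕ => C * Real.exp r ^ (d + 1) *
          ∏ j, ‖(Real.exp r * ‖z j‖) ^ α j / ((α j)! : ℝ)‖) ?_ fun α => ?_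
        · refine Summable.mul_left _ ?_
          have := summable_norm_prod_multiIndex (d := d + 1)
            (f := fun j n => (Real.exp r * ‖z j‖) ^ n / (n ! : ℝ))
            fun j => (Real.summable_pow_div_factorial _).norm
          simpa only [norm_prod] using this
        · rw [norm_mul]
          refine (mul_le_mul_of_nonneg_right (hb1 _ _) (norm_nonneg _)).trans (le_of_eq ?_)
          rw [norm_prod, Fin.prod_univ_succ, Fin.prod_univ_succ]
          simp only [Fin.tail, norm_div, norm_pow, norm_mul, norm_norm, Real.norm_natCast,
            Real.norm_of_nonneg (Real.exp_pos r).le, Finset.prod_div_distrib, mul_pow,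
            Finset.prod_mul_distrib]
          ring
      have hsum' := hsum
      rw [← (Fin.consEquiv fun _ : Fin (d + 1) => ℕ).summable_iff] at hsum'
      have hz : F z = ∑' α : Fin (d + 1) → ℕ, b (α 0) (Fin.tail α) * ∏ j, z j ^ α j := by
        rw [← (Fin.consEquiv fun _ : Fin (d + 1) => ℕ).tsum_eq]
        -- Summing first over the last d indices reproduces the one-variable Taylor series in `z 0`,
        -- whose sum is F z.
        have hfib := hsum'.hasSum.prod_fiberwise (g := fun n => a n (Fin.tail z) * z 0 ^ n) fun n => by
          have := (hb2 n (Fin.tail z)).mul_right (z 0 ^ n)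
          refine this.congr_fun ?_
          intro α
          simp [Fin.consEquiv, Fin.prod_univ_succ, Fin.tail]
          ring
        have htay := Complex.hasSum_taylorSeries_of_entire (hline (Fin.tail z)) 0 (z 0)
        rw [show (Fin.cons (z 0) (Fin.tail z) : Fin (d + 1) → ℂ) = z from Fin.cons_self_tail z] at htay
        refine (htay.unique ?_)
        refine hfib.congr_fun fun n => ?_
        simp only [a, smul_eq_mul, sub_zero]; ring
      rw [hz]
      exact hsum.hasSum

theorem eq_zero_of_hasSum_mul_pow_eq_zero {a : ℕ → ℂ}
    (h : ∀ z : ℂ, HasSum (fun n => a n * z ^ n) 0) : a = 0 := by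
  have hp : HasFPowerSeriesAt (0 : ℂ → ℂ) (FormalMultilinearSeries.ofScalars ℂ a) 0 := by
    rw [hasFPowerSeriesAt_iff]
    refine Filter.Eventually.of_forall fun z => ?_
    simpa [FormalMultilinearSeries.coeff_ofScalars, mul_comm] using h z
  have h0 := hp.eq_zero
  funext n
  rw [← FormalMultilinearSeries.coeff_ofScalars (𝕜 := ℂ) (p := a) (n := n), h0]
  rfl

theorem eq_zero_of_hasSum_mul_multiIndex_pow_eq_zero : ∀ {d : ℕ} {b : (Fin d → ℕ) → ℂ},
    (∀ z : Fin d → ℂ, HasSum (fun α => b α * ∏ j, z j ^ α j) 0) → b = 0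
  | 0, b, h => by
    funext α
    have h1 := (h 0).unique (hasSum_unique _)
    rw [Finset.univ_eq_empty, Finset.prod_empty, mul_one] at h1
    exact (congrArg b (Subsingleton.elim _ _)).trans h1.symm
  | d + 1, b, h => by
    have hs : ∀ (ζ : ℂ) (x : Fin d → ℂ), HasSum (fun q : ℕ × (Fin d → ℕ) =>
        (b (Fin.cons (α := fun _ => ℕ) q.1 q.2) * ∏ j, x j ^ q.2 j) * ζ ^ q.1) 0 := by
      intro ζ x
      have := h (Fin.cons ζ x)
      rw [← (Fin.consEquiv fun _ : Fin (d + 1) => ℕ).hasSum_iff] at this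
      refine this.congr_fun fun q => ?_
      simp [Fin.consEquiv, Fin.prod_univ_succ]
      ring
    have hfib : ∀ (n : ℕ) (x : Fin d → ℂ),
        Summable fun α : Fin d → ℕ => b (Fin.cons (α := fun _ => ℕ) n α) * ∏ j, x j ^ α j := by
      intro n x
      -- Taking ζ = 1 removes the power of ζ, so each fibre is summable.
      have := (hs 1 x).summable.prod_factor n
      simpa using this
    have hzero : ∀ x : Fin d → ℂ, (fun n => ∑' α : Fin d → ℕ,
        b (Fin.cons (α := fun _ => ℕ) n α) * ∏ j, x j ^ α j) = 0 := fun x =>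
      eq_zero_of_hasSum_mul_pow_eq_zero fun ζ =>
        (hs ζ x).prod_fiberwise fun n => (hfib n x).hasSum.mul_right (ζ ^ n)
    have hb : ∀ n, (fun α : Fin d → ℕ => b (Fin.cons (α := fun _ => ℕ) n α)) = 0 := fun n =>
      eq_zero_of_hasSum_mul_multiIndex_pow_eq_zero fun x => by
        have := (hfib n x).hasSum
        rwa [congrFun (hzero x) n] at this
    funext α
    rw [← Fin.cons_self_tail α]
    exact congrFun (hb (α 0)) (Fin.tail α)

/-! ### The bijection between 𝓗_♭ and 𝓐_♭. -/

theorem norm_le_of_mem_HFlat_bound {d : ℕ} {c : FormalHermiteSeries d} {C R : ℝ}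
    (hR : 0 < R)
    (hc : ∀ α, ‖c α‖ ≤ C * (R ^ multiLength α / Real.sqrt (multiFactorial α))) (α : Fin d → ℕ) :
    ‖c α‖ ≤ C * R ^ multiLength α := by
  have hC : 0 ≤ C := nonneg_of_mul_nonneg_left ((norm_nonneg _).trans (hc α))
    (by have := multiFactorial_pos α; positivity)
  refine (hc α).trans (mul_le_mul_of_nonneg_left ?_ hC)
  have h1 : (1 : ℝ) ≤ √(multiFactorial α : ℝ) :=
    Real.one_le_sqrt.2 (by exact_mod_cast multiFactorial_pos α)
  exact div_le_self (by positivity) h1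

theorem differentiable_monomialE {d : ℕ} (α : Fin d → ℕ) : Differentiable ℂ (monomialE α) := by
  unfold monomialE
  fun_prop

theorem differentiable_bargmannTransform {d : ℕ} {c : FormalHermiteSeries d} {C A : ℝ}
    (hC : 0 ≤ C) (hA : 0 ≤ A)
    (hc : ∀ α, ‖c α‖ ≤ C * A ^ multiLength α) : Differentiable ℂ (bargmannTransform c) := by
  intro z₀
  have hu : Summable fun α : Fin d → ℕ =>
      C * ((A * (‖z₀‖ + 2)) ^ multiLength α / √(multiFactorial α : ℝ)) :=
    (summable_pow_multiLength_div_sqrt (d := d) (A * (‖z₀‖ + 2))).mul_left C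
  refine (hasFDerivAt_tsum_of_isPreconnected (𝕜 := ℂ) hu (s := Metric.ball z₀ 1) Metric.isOpen_ball
    (convex_ball z₀ 1).isPreconnected
    (fun α z _ => ((differentiable_monomialE α z).hasFDerivAt.const_mul (c α))) (fun α z hz => ?_)
    (Metric.mem_ball_self one_pos)
    (summable_norm_mul_monomialE hc z₀).of_norm (Metric.mem_ball_self one_pos)).differentiableAt
  rw [norm_smul, mul_pow, mul_div_assoc, ← mul_assoc]
  refine mul_le_mul (hc α) ?_ (norm_nonneg _) (by positivity)
  refine norm_fderiv_le_of_norm_le_on_closedBall (differentiable_monomialE α) fun w hw =>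
    norm_monomialE_le α ?_
  rw [Metric.mem_ball, dist_eq_norm] at hz
  linarith [norm_sub_norm_le w z, norm_sub_norm_le z z₀]

/-- The two factors √(α!) multiply to α!, so the series is dominated by a product of d exponential
series in R‖z j‖. -/
theorem norm_bargmannTransform_le_of_HFlat_bound {d : ℕ} {c : FormalHermiteSeries d} {C R : ℝ}
    (hR : 0 < R)
    (hc : ∀ α, ‖c α‖ ≤ C * (R ^ multiLength α / Real.sqrt (multiFactorial α))) (z : CSpace d) :
    ‖bargmannTransform c z‖ ≤ C * Real.exp (R * d * ‖z‖) := by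
  have hC : 0 ≤ C := by
    have := (norm_nonneg _).trans (hc 0)
    exact nonneg_of_mul_nonneg_left this (by have := multiFactorial_pos (0 : Fin d → ℕ); positivity)
  have hs := hasSum_prod_multiIndex (f := fun j n => (R * ‖z j‖) ^ n / (n ! : ℝ))
    (s := fun j => Real.exp (R * ‖z j‖)) (fun j => (Real.summable_pow_div_factorial _).norm)
    fun j => by
      rw [Real.exp_eq_exp_ℝ]
      exact NormedSpace.expSeries_div_hasSum_exp (R * ‖z j‖)
  refine (norm_tsum_le_tsum_norm
    (summable_norm_mul_monomialE (norm_le_of_mem_HFlat_bound hR hc) z)).trans ?_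
  calc ∑' α, ‖c α * monomialE α z‖
      ≤ ∑' α : Fin d → ℕ, C * ∏ j, (R * ‖z j‖) ^ α j / ((α j)! : ℝ) := by
        refine (summable_norm_mul_monomialE (norm_le_of_mem_HFlat_bound hR hc) z).tsum_le_tsum
          (fun α => ?_) (hs.summable.mul_left C)
        rw [norm_mul, norm_monomialE]
        refine (mul_le_mul_of_nonneg_right (hc α) (by positivity)).trans (le_of_eq ?_)
        rw [Finset.prod_div_distrib, ← Nat.cast_prod, ← multiFactorial]
        simp_rw [mul_pow]
        rw [Finset.prod_mul_distrib, ← pow_multiLength, mul_assoc, div_mul_div_comm,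
          Real.mul_self_sqrt (by positivity)]
    _ = C * Real.exp (R * ∑ j, ‖z j‖) := by
        rw [tsum_mul_left, hs.tsum_eq, Finset.mul_sum, Real.exp_sum]
    _ ≤ C * Real.exp (R * d * ‖z‖) := by
        rw [mul_assoc R]
        gcongr
        calc ∑ j, ‖z j‖ ≤ ∑ _j : Fin d, ‖z‖ := Finset.sum_le_sum fun j _ => PiLp.norm_apply_le z j
          _ = d * ‖z‖ := by simp

theorem bargmannTransform_mem_AFlat {d : ℕ} {c : FormalHermiteSeries d} (hc : c ∈ HFlat d) :
    bargmannTransform c ∈ AFlat d := by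
  obtain ⟨R, hR, C, hC⟩ := hc
  have hC0 : 0 ≤ C := nonneg_of_mul_nonneg_left ((norm_nonneg _).trans (hC 0))
    (by have := multiFactorial_pos (0 : Fin d → ℕ); positivity)
  refine ⟨differentiable_bargmannTransform hC0 hR.le (norm_le_of_mem_HFlat_bound hR hC),
    -- The summand 1 keeps the exponent positive when d = 0.
    R * d + 1, by positivity, C, fun z => ?_⟩
  refine (norm_bargmannTransform_le_of_HFlat_bound hR hC z).trans ?_
  gcongr
  linarith

/-- The Bargmann transform is injective on the formal series for which the power series converges
everywhere. -/
theorem eq_of_bargmannTransform_eq {d : ℕ} {c c' : FormalHermiteSeries d}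
    (hc : ∀ z, Summable fun α => c α * monomialE α z)
    (hc' : ∀ z, Summable fun α => c' α * monomialE α z)
    (h : bargmannTransform c = bargmannTransform c') : c = c' := by
  have h0 : (fun α => (c α - c' α) / (√(multiFactorial α : ℝ) : ℂ)) = 0 :=
    eq_zero_of_hasSum_mul_multiIndex_pow_eq_zero fun z => by
      have h1 := (hc (WithLp.toLp 2 z)).hasSum.sub (hc' (WithLp.toLp 2 z)).hasSum
      have h2 := congrFun h (WithLp.toLp 2 z)
      simp only [bargmannTransform] at h2
      rw [h2, sub_self] at h1
      refine h1.congr_fun fun α => ?_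
      simp only [monomialE]
      ring
  funext α
  have h1 := congrFun h0 α
  have h2 : (√(multiFactorial α : ℝ) : ℂ) ≠ 0 := by
    have := multiFactorial_pos α
    exact_mod_cast (by positivity : √(multiFactorial α : ℝ) ≠ 0)
  simpa [h2, sub_eq_zero] using h1

/-- The Euclidean norm is at most ∑ ‖z j‖, so the Taylor expansion applies with the same r.
Multiplying its coefficients by √(α!) turns 1/α! into 1/√(α!). -/
theorem exists_mem_HFlat_of_mem_AFlat {d : ℕ} {F : CSpace d → ℂ} (hF : F ∈ AFlat d) :
    ∃ c ∈ HFlat d, bargmannTransform c = F := by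
  obtain ⟨hd, r, hr, C, hC⟩ := hF
  have hC0 : 0 ≤ C := nonneg_of_mul_nonneg_left ((norm_nonneg _).trans (hC 0)) (Real.exp_pos _)
  obtain ⟨b, hb1, hb2⟩ := exists_hasSum_of_exponential_type (F := fun z : Fin d → ℂ => F (WithLp.toLp 2 z))
    (C := C) (r := r)
    (hd.comp (PiLp.continuousLinearEquiv 2 ℂ (fun _ : Fin d => ℂ)).symm.differentiable) hr.le
    fun z => (hC _).trans (by
      gcongr
      rw [EuclideanSpace.norm_eq]
      refine Real.sqrt_le_iff.2 ⟨Finset.sum_nonneg fun _ _ => norm_nonneg _, ?_⟩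
      exact Finset.sum_sq_le_sq_sum_of_nonneg fun _ _ => norm_nonneg _)
  refine ⟨fun α => b α * (√(multiFactorial α : ℝ) : ℂ), ⟨Real.exp r, Real.exp_pos r,
    C * Real.exp r ^ d, fun α => ?_⟩, funext fun z => ?_⟩
  · have hpos : 0 < √(multiFactorial α : ℝ) := by
      have := multiFactorial_pos α
      positivity
    rw [norm_mul, Complex.norm_real, Real.norm_of_nonneg hpos.le]
    refine (mul_le_mul_of_nonneg_right (hb1 α) hpos.le).trans (le_of_eq ?_)
    rw [Finset.prod_div_distrib, ← pow_multiLength, ← Nat.cast_prod, ← multiFactorial]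
    have h2 := Real.mul_self_sqrt (Nat.cast_nonneg (α := ℝ) (multiFactorial α))
    have h3 : (0 : ℝ) < multiFactorial α := by exact_mod_cast multiFactorial_pos α
    field_simp
    rw [sq, h2]
  · refine (HasSum.tsum_eq ?_)
    refine (hb2 (WithLp.ofLp z)).congr_fun fun α => ?_
    have hpos : (√(multiFactorial α : ℝ) : ℂ) ≠ 0 := by
      have := multiFactorial_pos α
      exact_mod_cast (by positivity : √(multiFactorial α : ℝ) ≠ 0)
    simp only [monomialE]
    field_simp

theorem bijOn_bargmannTransform (d : ℕ) :
    Set.BijOn (bargmannTransform (d := d)) (HFlat d) (AFlat d) := by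
  have hs : ∀ c ∈ HFlat d, ∀ z, Summable fun α => c α * monomialE α z := by
    rintro c ⟨R, hR, C, hC⟩ z
    exact (summable_norm_mul_monomialE (norm_le_of_mem_HFlat_bound hR hC) z).of_norm
  exact ⟨fun c hc => bargmannTransform_mem_AFlat hc,
    fun c hc c' hc' h => eq_of_bargmannTransform_eq (hs c hc) (hs c' hc') h,
    fun F hF => exists_mem_HFlat_of_mem_AFlat hF⟩

/-! ### Hermite functions of one complex variable. -/

/-- The entire function `ζ ↦ e^{-ζ²}`. -/
noncomputable def complexGaussian (ζ : ℂ) : ℂ := Complex.exp (-ζ ^ 2)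

theorem differentiable_complexGaussian : Differentiable ℂ complexGaussian := by
  unfold complexGaussian
  fun_prop

theorem hasDerivAt_iteratedDeriv_complexGaussian (n : ℕ) (ζ : ℂ) :
    HasDerivAt (iteratedDeriv n complexGaussian) (iteratedDeriv (n + 1) complexGaussian ζ) ζ := by
  rw [iteratedDeriv_succ]
  have h : ContDiff ℂ (n + 1 : ℕ) complexGaussian := differentiable_complexGaussian.contDiff
  exact ((h.differentiable_iteratedDeriv n (by exact_mod_cast Nat.lt_succ_self n)) ζ).hasDerivAt

theorem iteratedDeriv_one_complexGaussian (ζ : ℂ) :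
    iteratedDeriv 1 complexGaussian ζ = -2 * ζ * complexGaussian ζ := by
  rw [iteratedDeriv_one]
  have h : HasDerivAt complexGaussian (Complex.exp (-ζ ^ 2) * (-(2 * ζ))) ζ := by
    refine HasDerivAt.cexp ?_
    simpa using! ((hasDerivAt_id ζ).pow 2).neg
  rw [h.deriv, complexGaussian]
  ring

/-- The first derivative is -2ζ times the Gaussian; differentiating the relation once more raises n
by one. This is the source of the Hermite equation. -/
theorem iteratedDeriv_complexGaussian_recurrence (n : ℕ) : ∀ ζ : ℂ,
    iteratedDeriv (n + 2) complexGaussian ζ =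
      -2 * ζ * iteratedDeriv (n + 1) complexGaussian ζ
        - 2 * (n + 1) * iteratedDeriv n complexGaussian ζ := by
  have hlin : ∀ ζ : ℂ, HasDerivAt (fun ζ : ℂ => -2 * ζ) (-2) ζ := fun ζ => by
    simpa using (hasDerivAt_id ζ).const_mul (-2)
  induction n with
  | zero =>
    intro ζ
    have h1 := hasDerivAt_iteratedDeriv_complexGaussian 1 ζ
    have h2 := (hlin ζ).mul (hasDerivAt_iteratedDeriv_complexGaussian 0 ζ)
    have e : iteratedDeriv 1 complexGaussian
        = (fun ζ : ℂ => -2 * ζ) * iteratedDeriv 0 complexGaussian := by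
      funext ζ
      simp [iteratedDeriv_one_complexGaussian]
    rw [← e] at h2
    rw [h1.unique h2]
    push_cast
    ring
  | succ n ih =>
    intro ζ
    have h1 := hasDerivAt_iteratedDeriv_complexGaussian (n + 2) ζ
    have h2 := ((hlin ζ).mul (hasDerivAt_iteratedDeriv_complexGaussian (n + 1) ζ)).sub
      ((hasDerivAt_iteratedDeriv_complexGaussian n ζ).const_mul (2 * ((n : ℂ) + 1)))
    have e : iteratedDeriv (n + 2) complexGaussian
        = (fun ζ : ℂ => -2 * ζ) * iteratedDeriv (n + 1) complexGaussian
          - fun ζ => 2 * ((n : ℂ) + 1) * iteratedDeriv n complexGaussian ζ := by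
      funext ζ
      simp [ih ζ]
    rw [← e] at h2
    rw [h1.unique h2]
    push_cast
    ring

theorem iteratedDeriv_complexGaussian_ofReal (n : ℕ) : ∀ y : ℝ,
    iteratedDeriv n complexGaussian y =
      ((iteratedDeriv n (fun t : ℝ => Real.exp (-t ^ 2)) y : ℝ) : ℂ) := by
  induction n with
  | zero => intro y; simp [complexGaussian]
  | succ n ih =>
    intro y
    have h1 := (hasDerivAt_iteratedDeriv_complexGaussian n (y : ℂ)).comp_ofReal
    have hs : ContDiff ℝ (n + 1 : ℕ) fun t : ℝ => Real.exp (-t ^ 2) := by fun_prop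
    have h2 := ((hs.differentiable_iteratedDeriv n
      (by exact_mod_cast Nat.lt_succ_self n)) y).hasDerivAt.ofReal_comp
    simp_rw [ih] at h1
    rw [h1.unique h2, iteratedDeriv_succ]

/-- The Hermite function of order `n` in one variable, as an entire function. -/
noncomputable def complexHermite (n : ℕ) (ζ : ℂ) : ℂ :=
  ((Real.pi ^ (-(1 : ℝ) / 4) * (-1) ^ n * (√(2 ^ n * n !))⁻¹ : ℝ) : ℂ) *
    (Complex.exp (ζ ^ 2 / 2) * iteratedDeriv n complexGaussian ζ)

theorem hasDerivAt_cexp_sq_half (ζ : ℂ) :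
    HasDerivAt (fun ζ : ℂ => Complex.exp (ζ ^ 2 / 2)) (Complex.exp (ζ ^ 2 / 2) * ζ) ζ := by
  refine HasDerivAt.cexp ?_
  simpa using! ((hasDerivAt_id ζ).pow 2).div_const 2

theorem hasDerivAt_complexHermite (n : ℕ) (ζ : ℂ) :
    HasDerivAt (complexHermite n)
      (((Real.pi ^ (-(1 : ℝ) / 4) * (-1) ^ n * (√(2 ^ n * n !))⁻¹ : ℝ) : ℂ) *
        (Complex.exp (ζ ^ 2 / 2) * ζ * iteratedDeriv n complexGaussian ζ +
          Complex.exp (ζ ^ 2 / 2) * iteratedDeriv (n + 1) complexGaussian ζ)) ζ :=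
  ((hasDerivAt_cexp_sq_half ζ).mul (hasDerivAt_iteratedDeriv_complexGaussian n ζ)).const_mul _

theorem differentiable_complexHermite (n : ℕ) : Differentiable ℂ (complexHermite n) :=
  fun ζ => (hasDerivAt_complexHermite n ζ).differentiableAt

/-- The Hermite differential equation. -/
theorem deriv_deriv_complexHermite (n : ℕ) (ζ : ℂ) :
    deriv (deriv (complexHermite n)) ζ = (ζ ^ 2 - (2 * n + 1)) * complexHermite n ζ := by
  have e : deriv (complexHermite n) = _ := funext fun ζ => (hasDerivAt_complexHermite n ζ).deriv
  rw [e]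
  have h := ((((hasDerivAt_cexp_sq_half ζ).mul (hasDerivAt_id ζ)).mul
    (hasDerivAt_iteratedDeriv_complexGaussian n ζ)).add ((hasDerivAt_cexp_sq_half ζ).mul
      (hasDerivAt_iteratedDeriv_complexGaussian (n + 1) ζ))).const_mul
    ((Real.pi ^ (-(1 : ℝ) / 4) * (-1) ^ n * (√(2 ^ n * n !))⁻¹ : ℝ) : ℂ)
  refine h.deriv.trans ?_
  rw [iteratedDeriv_complexGaussian_recurrence, complexHermite]
  simp only [Pi.mul_apply, id]
  ring

/-- Cauchy's estimate for e^{-ζ²} on the circle of radius √(n+1). There the Gaussian is at most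
e^{2n+4} e^{-Re(ζ²)/2}, whose last factor cancels the prefactor e^{ζ²/2}, while n!/(n+1)^{n/2} is
absorbed by the normalization. This crude bound suffices because only exponential growth in n
matters; the strip leaves room for derivatives on the real line. -/
theorem norm_complexHermite_le (n : ℕ) {ζ : ℂ} (hζ : |ζ.im| ≤ 1) :
    ‖complexHermite n ζ‖ ≤ Real.exp (2 * n + 4) := by
  set ρ : ℝ := √(n + 1) with hρ
  have hρ0 : 0 < ρ := by positivity
  have hρ2 : ρ ^ 2 = n + 1 := Real.sq_sqrt (by positivity)
  have hc := Complex.norm_iteratedDeriv_le_of_forall_mem_sphere_norm_le (c := ζ) (R := ρ)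
    (C := Real.exp (2 * n + 4) * Real.exp (-(ζ.re ^ 2 - ζ.im ^ 2) / 2)) n hρ0
    differentiable_complexGaussian.diffContOnCl fun w hw => by
      obtain ⟨v, rfl⟩ : ∃ v, w = ζ + v := ⟨w - ζ, by ring⟩
      rw [mem_sphere_iff_norm, add_sub_cancel_left] at hw
      have hv : v.re ^ 2 + v.im ^ 2 = n + 1 := by
        rw [← hρ2, ← hw, Complex.sq_norm, Complex.normSq_apply]; ring
      rw [complexGaussian, Complex.norm_exp, ← Real.exp_add]
      refine Real.exp_le_exp.2 ?_
      simp only [Complex.neg_re, sq, Complex.mul_re, Complex.add_re, Complex.add_im]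
      have h1 : ζ.im ^ 2 ≤ 1 := by rw [← sq_abs]; nlinarith [abs_nonneg ζ.im]
      -- Completing squares in ζ.re + 2 v.re and ζ.im - v.im bounds the exponent by 2|v|² plus 3/2,
      -- and |v|² = n + 1.
      nlinarith [sq_nonneg (ζ.re + 2 * v.re), sq_nonneg (ζ.im - v.im)]
  have hexp : ‖Complex.exp (ζ ^ 2 / 2)‖ = Real.exp ((ζ.re ^ 2 - ζ.im ^ 2) / 2) := by
    rw [Complex.norm_exp]
    congr 1
    have : ζ ^ 2 / 2 = ((1 / 2 : ℝ) : ℂ) * (ζ * ζ) := by push_cast; ring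
    rw [this, Complex.re_ofReal_mul, Complex.mul_re]
    ring
  have hπ : Real.pi ^ (-(1 : ℝ) / 4) ≤ 1 :=
    Real.rpow_le_one_of_one_le_of_nonpos (by linarith [Real.pi_gt_three]) (by norm_num)
  have hπ0 : 0 ≤ Real.pi ^ (-(1 : ℝ) / 4) := by positivity
  have hfac : (n ! : ℝ) ≤ √(2 ^ n * n !) * ρ ^ n := by
    refine (sq_le_sq₀ (by positivity) (by positivity)).1 ?_
    rw [mul_pow, Real.sq_sqrt (by positivity), ← pow_mul, mul_comm n 2, pow_mul, hρ2]
    have h1 : (n ! : ℝ) ≤ (n + 1 : ℝ) ^ n := by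
      have h1 : (n ! : ℝ) ≤ (n : ℝ) ^ n := by exact_mod_cast Nat.factorial_le_pow n
      exact h1.trans (by gcongr; linarith)
    have h2 : (1 : ℝ) ≤ 2 ^ n := one_le_pow₀ one_le_two
    have h3 : (0 : ℝ) ≤ n ! := by positivity
    calc (n ! : ℝ) ^ 2 = 1 * n ! * n ! := by ring
      _ ≤ _ := by gcongr
  have hs0 : 0 < √(2 ^ n * n ! : ℝ) := by positivity
  rw [complexHermite, norm_mul, norm_mul, hexp, Complex.norm_real, norm_mul, norm_mul, norm_pow,
    norm_neg, norm_one, one_pow, mul_one, norm_inv, Real.norm_of_nonneg hs0.le,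
    Real.norm_of_nonneg hπ0]
  calc Real.pi ^ (-(1 : ℝ) / 4) * (√(2 ^ n * n !))⁻¹ * (Real.exp ((ζ.re ^ 2 - ζ.im ^ 2) / 2) *
        ‖iteratedDeriv n complexGaussian ζ‖)
      ≤ 1 * (√(2 ^ n * n !))⁻¹ * (Real.exp ((ζ.re ^ 2 - ζ.im ^ 2) / 2) *
        (n ! * (Real.exp (2 * n + 4) * Real.exp (-(ζ.re ^ 2 - ζ.im ^ 2) / 2)) / ρ ^ n)) := by
        gcongr
    _ = (n ! / (√(2 ^ n * n !) * ρ ^ n)) * Real.exp (2 * n + 4) := by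
        rw [neg_div, Real.exp_neg]
        field_simp
    _ ≤ 1 * Real.exp (2 * n + 4) := by
        gcongr
        exact div_le_one_of_le₀ hfac (by positivity)
    _ = _ := one_mul _

theorem norm_iteratedDeriv_complexHermite_le (n k : ℕ) (y : ℝ) :
    ‖iteratedDeriv k (complexHermite n) y‖ ≤ k ! * Real.exp (2 * n + 4) := by
  have h := Complex.norm_iteratedDeriv_le_of_forall_mem_sphere_norm_le (c := (y : ℂ)) (R := 1)
    (C := Real.exp (2 * n + 4)) k one_pos (differentiable_complexHermite n).diffContOnCl
    fun w hw => norm_complexHermite_le n (by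
      rw [mem_sphere_iff_norm] at hw
      have := Complex.abs_im_le_norm (w - y)
      simpa [hw] using this)
  simpa using h

/-- The generating function of the normalized Hermite functions in one variable. -/
noncomputable def hermiteGenerating (w y : ℂ) : ℂ :=
  ((Real.pi ^ (-(1 : ℝ) / 4) : ℝ) : ℂ) * Complex.exp (-y ^ 2 / 2 + √2 * w * y - w ^ 2 / 2)

theorem hasSum_hermiteGenerating (w y : ℂ) :
    HasSum (fun n : ℕ => w ^ n / (√(n ! : ℝ) : ℂ) * complexHermite n y) (hermiteGenerating w y) := by
  have h2 : ((√2 : ℝ) : ℂ) ≠ 0 := by exact_mod_cast (by positivity : √(2 : ℝ) ≠ 0)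
  have h22 : ((√2 : ℝ) : ℂ) ^ 2 = 2 := by
    exact_mod_cast Real.sq_sqrt (show (0 : ℝ) ≤ 2 by norm_num)
  -- The generating series is the Taylor series of e^{-ζ²} at y with increment -w/√2; the sign and
  -- the powers of √2 match the normalization of h_n.
  have h := (Complex.hasSum_taylorSeries_of_entire differentiable_complexGaussian y
    (y - w / √2)).mul_left (((Real.pi ^ (-(1 : ℝ) / 4) : ℝ) : ℂ) * Complex.exp (y ^ 2 / 2))
  have e : hermiteGenerating w y = ((Real.pi ^ (-(1 : ℝ) / 4) : ℝ) : ℂ) * Complex.exp (y ^ 2 / 2) *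
      complexGaussian (y - w / √2) := by
    rw [hermiteGenerating, complexGaussian, mul_assoc _ (Complex.exp _), ← Complex.exp_add]
    obtain ⟨u, rfl⟩ : ∃ u : ℂ, w = √2 * u := ⟨w / √2, by field_simp⟩
    rw [mul_div_cancel_left₀ _ h2]
    congr 2
    linear_combination (u * y - u ^ 2 / 2) * h22
  rw [e]
  refine h.congr_fun fun n => ?_
  have hf : ((√(n ! : ℝ) : ℝ) : ℂ) ^ 2 = (n ! : ℂ) := by
    exact_mod_cast Real.sq_sqrt (show (0 : ℝ) ≤ (n ! : ℝ) by positivity)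
  have hf0 : ((√(n ! : ℝ) : ℝ) : ℂ) ≠ 0 := by
    have := Nat.factorial_pos n
    exact_mod_cast (by positivity : √(n ! : ℝ) ≠ 0)
  have hs : √(2 ^ n * n ! : ℝ) = √2 ^ n * √(n ! : ℝ) := by
    have h3 : (2 : ℝ) ^ n = (√2 ^ n) ^ 2 := by
      rw [← pow_mul, mul_comm n 2, pow_mul, Real.sq_sqrt (by norm_num)]
    rw [Real.sqrt_mul (by positivity), h3, Real.sqrt_sq (by positivity)]
  rw [complexHermite, hs, smul_eq_mul, smul_eq_mul, ← hf,
    show y - w / √2 - y = -1 * w / (√2 : ℂ) by ring, div_pow, mul_pow]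
  push_cast
  field_simp

/-! ### The harmonic oscillator on Hermite series. -/

/-- Derivatives along coordinate lines are unique, so they agree with the Fréchet ones. A series
then only has to be differentiated term by term in one real variable. -/
theorem laplacian_eq_sum_of_hasDerivAt {d : ℕ} {f : RSpace d → ℂ} (hf : ContDiff ℝ 2 f)
    {x : RSpace d} {f₁ : Fin d → ℝ → ℂ} {f₂ : Fin d → ℂ}
    (h₁ : ∀ i t, HasDerivAt (fun t : ℝ => f (x + t • EuclideanSpace.single i (1 : ℝ))) (f₁ i t) t)
    (h₂ : ∀ i, HasDerivAt (f₁ i) (f₂ i) 0) :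
    Laplacian.laplacian f x = ∑ i, f₂ i := by
  rw [InnerProductSpace.laplacian_eq_iteratedFDeriv_orthonormalBasis f
    (EuclideanSpace.basisFun (Fin d) ℝ)]
  refine Finset.sum_congr rfl fun i _ => ?_
  set v : RSpace d := EuclideanSpace.single i (1 : ℝ) with hv
  have hline : ∀ t : ℝ, HasDerivAt (fun t : ℝ => x + t • v) v t := fun t => by
    simpa using ((hasDerivAt_id t).smul_const v).const_add x
  have hd : Differentiable ℝ f := hf.differentiable (by norm_num)
  have hd' : Differentiable ℝ (fderiv ℝ f) :=
    (hf.fderiv_right (m := 1) (by norm_num)).differentiable (by norm_num)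
  have e : f₁ i = fun t => fderiv ℝ f (x + t • v) v := funext fun t =>
    (h₁ i t).unique ((hd _).hasFDerivAt.comp_hasDerivAt t (hline t))
  have h3 : HasDerivAt (fun t : ℝ => fderiv ℝ f (x + t • v) v)
      (fderiv ℝ (fderiv ℝ f) (x + (0 : ℝ) • v) v v) 0 :=
    ((ContinuousLinearMap.apply ℝ ℂ v).hasFDerivAt).comp_hasDerivAt 0
      ((hd' _).hasFDerivAt.comp_hasDerivAt 0 (hline 0))
  have h2 := h₂ i
  rw [e] at h2
  rw [iteratedFDeriv_two_apply, h2.unique h3]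
  simp [hv]

theorem hermiteFunction_eq_prod {d : ℕ} (α : Fin d → ℕ) (x : RSpace d) :
    hermiteFunction α x = ∏ j, complexHermite (α j) (x j) := by
  have h1 : ∀ j, complexHermite (α j) (x j) =
      ((Real.pi ^ (-(1 : ℝ) / 4) * (-1) ^ α j * (√(2 ^ α j * (α j)!))⁻¹ *
        (Real.exp (x j ^ 2 / 2) *
          iteratedDeriv (α j) (fun t : ℝ => Real.exp (-t ^ 2)) (x j)) : ℝ) : ℂ) := fun j => by
    rw [complexHermite, iteratedDeriv_complexGaussian_ofReal]
    push_cast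
    ring
  rw [Finset.prod_congr rfl fun j _ => h1 j, ← Complex.ofReal_prod, hermiteFunction]
  congr 1
  simp only [Finset.prod_mul_distrib, Finset.prod_const, Finset.card_univ, Fintype.card_fin,
    Finset.prod_inv_distrib]
  rw [← Real.exp_sum, ← Finset.sum_div, ← EuclideanSpace.real_norm_sq_eq, ← pow_multiLength,
    ← Real.sqrt_prod _ fun _ _ => by positivity, Finset.prod_mul_distrib, ← pow_multiLength,
    ← Real.rpow_mul_natCast Real.pi_pos.le, multiFactorial]
  push_cast
  rw [show -(1 : ℝ) / 4 * d = -(d : ℝ) / 4 by ring]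
  ring

theorem contDiff_prod_apply {d : ℕ} {g : Fin d → ℂ → ℂ} (hg : ∀ j, Differentiable ℂ (g j)) :
    ContDiff ℝ (⊤ : ℕ∞) fun x : RSpace d => ∏ j, g j (x j) := by
  refine contDiff_prod fun j _ => ?_
  have h1 : ContDiff ℝ (⊤ : ℕ∞) (g j) := (hg j).contDiff.restrict_scalars ℝ
  exact h1.comp (Complex.ofRealCLM.contDiff.comp
    (PiLp.proj 2 (fun _ : Fin d => ℝ) j : RSpace d →L[ℝ] ℝ).contDiff)

theorem contDiff_hermiteFunction {d : ℕ} (α : Fin d → ℕ) :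
    ContDiff ℝ (⊤ : ℕ∞) (hermiteFunction α) := by
  rw [show hermiteFunction α = _ from funext (hermiteFunction_eq_prod α)]
  exact contDiff_prod_apply fun j => differentiable_complexHermite (α j)

theorem hermiteFunction_line {d : ℕ} (α : Fin d → ℕ) (x : RSpace d) (i : Fin d) (t : ℝ) :
    hermiteFunction α (x + t • EuclideanSpace.single i (1 : ℝ)) =
      complexHermite (α i) ((x i + t : ℝ) : ℂ) *
        ∏ j ∈ Finset.univ.erase i, complexHermite (α j) (x j) := by
  rw [hermiteFunction_eq_prod, ← Finset.mul_prod_erase _ _ (Finset.mem_univ i)]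
  congr 1
  · simp
  · refine Finset.prod_congr rfl fun j hj => ?_
    simp [Finset.ne_of_mem_erase hj]

/-- A common bound for the Hermite function `h_α` and its first order partial derivatives. -/
noncomputable def hermiteBound {d : ℕ} (α : Fin d → ℕ) : ℝ :=
  Real.exp (2 * multiLength α + 4 * d)

theorem hermiteBound_eq_prod {d : ℕ} (α : Fin d → ℕ) :
    hermiteBound α = ∏ j, Real.exp (2 * α j + 4) := by
  rw [hermiteBound, ← Real.exp_sum, Finset.sum_add_distrib, ← Finset.mul_sum, multiLength]
  simp [mul_comm]

theorem norm_iteratedDeriv_mul_prod_erase_le {d : ℕ} (α : Fin d → ℕ) (x : RSpace d) (i : Fin d)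
    (k : ℕ) (t : ℝ) :
    ‖iteratedDeriv k (complexHermite (α i)) (t : ℂ) *
        ∏ j ∈ Finset.univ.erase i, complexHermite (α j) (x j)‖ ≤ k ! * hermiteBound α := by
  rw [norm_mul, norm_prod, hermiteBound_eq_prod, ← Finset.mul_prod_erase _ _ (Finset.mem_univ i),
    ← mul_assoc]
  gcongr with j
  · exact norm_iteratedDeriv_complexHermite_le _ _ _
  · simpa using norm_iteratedDeriv_complexHermite_le (α j) 0 (x j)

theorem norm_hermiteFunction_le {d : ℕ} (α : Fin d → ℕ) (x : RSpace d) :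
    ‖hermiteFunction α x‖ ≤ hermiteBound α := by
  rw [hermiteFunction_eq_prod, norm_prod, hermiteBound_eq_prod]
  gcongr with j
  simpa using norm_iteratedDeriv_complexHermite_le (α j) 0 (x j)

/-- The eigenvalue `2|α| + d` of the harmonic oscillator. -/
noncomputable def harmonicEigenvalue {d : ℕ} (α : Fin d → ℕ) : ℝ := 2 * multiLength α + d

theorem harmonicEigenvalue_nonneg {d : ℕ} (α : Fin d → ℕ) : 0 ≤ harmonicEigenvalue α := by
  unfold harmonicEigenvalue
  positivity

theorem hasDerivAt_comp_ofReal_add {g : ℂ → ℂ} (hg : Differentiable ℂ g) (y t : ℝ) (k : ℂ) :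
    HasDerivAt (fun t : ℝ => g ((y + t : ℝ) : ℂ) * k) (deriv g ((y + t : ℝ) : ℂ) * k) t := by
  have h := (hg ((y + t : ℝ) : ℂ)).hasDerivAt.comp_ofReal
  exact (HasDerivAt.comp_const_add (f := fun t : ℝ => g t) y t h).mul_const k

/-- The harmonic oscillator acts diagonally on Hermite series. -/
theorem harmonicOscillator_eq_tsum {d : ℕ} {Φ : RSpace d → ℂ} (hΦ : ContDiff ℝ (⊤ : ℕ∞) Φ)
    {c : (Fin d → ℕ) → ℂ} (hc : Summable fun α => ‖c α‖ * hermiteBound α)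
    (h : ∀ x, Φ x = ∑' α, c α * hermiteFunction α x) (x : RSpace d) :
    harmonicOscillator Φ x = ∑' α, (harmonicEigenvalue α * c α) * hermiteFunction α x := by
  have hsum : ∀ x, Summable fun α => c α * hermiteFunction α x := fun x =>
    Summable.of_norm_bounded hc fun α => by
      rw [norm_mul]
      exact mul_le_mul_of_nonneg_left (norm_hermiteFunction_le α x) (norm_nonneg _)
  let r : Fin d → (Fin d → ℕ) → ℂ := fun i α =>
    ∏ j ∈ Finset.univ.erase i, complexHermite (α j) (x j)
  -- One majorant, used with k = 0, 1, 2, justifies convergence and both termwise differentiations.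
  have hbound : ∀ (i : Fin d) (k : ℕ) (α : Fin d → ℕ) (t : ℝ),
      ‖c α * (iteratedDeriv k (complexHermite (α i)) (t : ℂ) * r i α)‖ ≤
        k ! * (‖c α‖ * hermiteBound α) := fun i k α t => by
    rw [norm_mul, mul_left_comm]
    exact mul_le_mul_of_nonneg_left (norm_iteratedDeriv_mul_prod_erase_le α x i k t)
      (norm_nonneg _)
  have hdd : ∀ n, Differentiable ℂ (deriv (complexHermite n)) := fun n =>
    (differentiable_complexHermite n).contDiff.differentiable_deriv_two
  have h₁ : ∀ i t, HasDerivAt (fun t : ℝ => Φ (x + t • EuclideanSpace.single i (1 : ℝ)))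
      (∑' α, c α * (deriv (complexHermite (α i)) ((x i + t : ℝ) : ℂ) * r i α)) t := by
    intro i t
    have e : (fun t : ℝ => Φ (x + t • EuclideanSpace.single i (1 : ℝ))) = fun t : ℝ =>
        ∑' α, c α * (complexHermite (α i) ((x i + t : ℝ) : ℂ) * r i α) := by
      funext t
      rw [h]
      exact tsum_congr fun α => by rw [hermiteFunction_line]
    rw [e]
    refine hasDerivAt_tsum hc (fun α t => (hasDerivAt_comp_ofReal_add
      (differentiable_complexHermite (α i)) (x i) t (r i α)).const_mul (c α)) (fun α t => ?_)
      (y₀ := 0) ?_ t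
    · simpa using hbound i 1 α (x i + t)
    · exact Summable.of_norm_bounded hc fun α => by simpa using hbound i 0 α (x i)
  have hsum2 : ∀ i, Summable fun α =>
      c α * (deriv (deriv (complexHermite (α i))) (x i) * r i α) := fun i =>
    Summable.of_norm_bounded (hc.mul_left 2) fun α => by
      simpa [iteratedDeriv_succ] using hbound i 2 α (x i)
  have h₂ : ∀ i, HasDerivAt (fun t : ℝ =>
      ∑' α, c α * (deriv (complexHermite (α i)) ((x i + t : ℝ) : ℂ) * r i α))
      (∑' α, c α * (deriv (deriv (complexHermite (α i))) (x i) * r i α)) 0 := by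
    intro i
    have := hasDerivAt_tsum (hc.mul_left 2) (y₀ := 0)
      (g := fun α (t : ℝ) => c α * (deriv (complexHermite (α i)) ((x i + t : ℝ) : ℂ) * r i α))
      (fun α t => (hasDerivAt_comp_ofReal_add (hdd (α i)) (x i) t (r i α)).const_mul (c α))
      (fun α t => by simpa [iteratedDeriv_succ] using hbound i 2 α (x i + t))
      (Summable.of_norm_bounded hc fun α => by simpa using hbound i 1 α (x i)) 0
    simpa using this
  have h2 : (2 : WithTop ℕ∞) ≤ ((⊤ : ℕ∞) : WithTop ℕ∞) :=
    WithTop.coe_le_coe.2 (le_top : (2 : ℕ∞) ≤ ⊤)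
  rw [harmonicOscillator, laplacian_eq_sum_of_hasDerivAt (hΦ.of_le h2) h₁ h₂, h x, ← tsum_mul_left,
    ← Summable.tsum_finsetSum fun i _ => hsum2 i,
    ← ((hsum x).mul_left _).tsum_sub (summable_sum fun i _ => hsum2 i)]
  refine tsum_congr fun α => ?_
  -- By the Hermite equation the second derivatives sum to (|x|² - (2|α| + d)) h_α, so the |x|²
  -- terms cancel in H.
  have e : ∀ i, c α * (deriv (deriv (complexHermite (α i))) (x i) * r i α) =
      c α * (((x i : ℂ) ^ 2 - (2 * α i + 1)) * hermiteFunction α x) := fun i => by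
    have := hermiteFunction_line α x i 0
    rw [zero_smul, add_zero, add_zero] at this
    rw [this, deriv_deriv_complexHermite, mul_assoc]
  rw [Finset.sum_congr rfl fun i _ => e i, ← Finset.mul_sum, ← Finset.sum_mul,
    Finset.sum_sub_distrib, Finset.sum_add_distrib, ← Finset.mul_sum,
    EuclideanSpace.real_norm_sq_eq, harmonicEigenvalue, multiLength]
  push_cast
  simp
  ring

theorem harmonicPower_eq_tsum {d : ℕ} {Φ : RSpace d → ℂ} (hΦ : ContDiff ℝ (⊤ : ℕ∞) Φ)
    {c : (Fin d → ℕ) → ℂ}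
    (hc : ∀ N : ℕ, Summable fun α => harmonicEigenvalue α ^ N * (‖c α‖ * hermiteBound α))
    (h : ∀ x, Φ x = ∑' α, c α * hermiteFunction α x) (N : ℕ) : ∀ x : RSpace d,
    harmonicPower N Φ x =
      ∑' α, ((harmonicEigenvalue α : ℂ) ^ N * c α) * hermiteFunction α x := by
  induction N with
  | zero => simpa [harmonicPower] using h
  | succ N ih =>
    intro x
    rw [harmonicPower, Function.iterate_succ_apply', ← harmonicPower,
      harmonicOscillator_eq_tsum (harmonicPower_contDiff hΦ N) ?_ ih]
    · exact tsum_congr fun α => by ring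
    · refine (hc N).congr fun α => ?_
      rw [norm_mul, norm_pow, Complex.norm_real, Real.norm_of_nonneg (harmonicEigenvalue_nonneg α),
        mul_assoc]

/-- The weights for which weighted `ℓ¹` norms of Hermite coefficients control `‖·‖_η`. -/
noncomputable def pilipovicWeight {d : ℕ} (η : ℝ) (α : Fin d → ℕ) : ℝ :=
  Real.exp (harmonicEigenvalue α / η) * hermiteBound α

/-- This is s^N/N! ≤ e^s at s = λ_α/η. It converts the supremum over N in ‖·‖_η into a weight that
is exponential in |α|. -/
theorem harmonicEigenvalue_pow_mul_le {d : ℕ} {η : ℝ} (hη : 0 < η) (α : Fin d → ℕ) (N : ℕ) :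
    harmonicEigenvalue α ^ N * hermiteBound α ≤ η ^ N * N ! * pilipovicWeight η α := by
  have h := Real.pow_div_factorial_le_exp (x := harmonicEigenvalue α / η)
    (div_nonneg (harmonicEigenvalue_nonneg α) hη.le) N
  have hb : 0 ≤ hermiteBound α := (Real.exp_pos _).le
  rw [div_le_iff₀ (by positivity), div_pow, div_le_iff₀ (by positivity)] at h
  calc _ ≤ Real.exp (harmonicEigenvalue α / η) * N ! * η ^ N * hermiteBound α := by gcongr
    _ = _ := by rw [pilipovicWeight]; ring

/-- H acts diagonally, so a weighted ℓ¹ norm of the coefficients controls ‖·‖_η. It serves single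
Hermite functions, the Gaussian windows and the remainders of their expansions alike. -/
theorem norm_harmonicPower_le {d : ℕ} {Φ : RSpace d → ℂ} (hΦ : ContDiff ℝ (⊤ : ℕ∞) Φ)
    {c : (Fin d → ℕ) → ℂ} {η T : ℝ} (hη : 0 < η)
    (hc : HasSum (fun α => ‖c α‖ * pilipovicWeight η α) T)
    (h : ∀ x, HasSum (fun α => c α * hermiteFunction α x) (Φ x)) (N : ℕ) (x : RSpace d) :
    ‖harmonicPower N Φ x‖ ≤ T * (η ^ N * N !) := by
  have hle : ∀ (N : ℕ) (α : Fin d → ℕ), harmonicEigenvalue α ^ N * (‖c α‖ * hermiteBound α) ≤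
      ‖c α‖ * pilipovicWeight η α * (η ^ N * N !) := fun N α => by
    calc _ = ‖c α‖ * (harmonicEigenvalue α ^ N * hermiteBound α) := by ring
      _ ≤ ‖c α‖ * (η ^ N * N ! * pilipovicWeight η α) :=
        mul_le_mul_of_nonneg_left (harmonicEigenvalue_pow_mul_le hη α N) (norm_nonneg _)
      _ = _ := by ring
  have hb : ∀ α : Fin d → ℕ, 0 ≤ hermiteBound α := fun α => (Real.exp_pos _).le
  have hsum : ∀ N : ℕ, Summable fun α => harmonicEigenvalue α ^ N * (‖c α‖ * hermiteBound α) :=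
    fun N => Summable.of_nonneg_of_le
      (fun α => mul_nonneg (pow_nonneg (harmonicEigenvalue_nonneg α) N)
        (mul_nonneg (norm_nonneg _) (hb α))) (hle N) (hc.summable.mul_right _)
  rw [harmonicPower_eq_tsum hΦ hsum (fun x => (h x).tsum_eq.symm)]
  refine tsum_of_norm_bounded (hc.mul_right (η ^ N * N ! : ℝ)) fun α => ?_
  refine le_trans ?_ (hle N α)
  rw [norm_mul, norm_mul, norm_pow, Complex.norm_real,
    Real.norm_of_nonneg (harmonicEigenvalue_nonneg α), mul_assoc]
  exact mul_le_mul_of_nonneg_left (mul_le_mul_of_nonneg_left (norm_hermiteFunction_le α x)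
    (norm_nonneg _)) (pow_nonneg (harmonicEigenvalue_nonneg α) N)

theorem mem_pilipovicFunctions_of_hasSum {d : ℕ} {Φ : RSpace d → ℂ}
    (hΦ : ContDiff ℝ (⊤ : ℕ∞) Φ) {c : (Fin d → ℕ) → ℂ}
    (hc : ∀ η : ℝ, 0 < η → Summable fun α => ‖c α‖ * pilipovicWeight η α)
    (h : ∀ x, HasSum (fun α => c α * hermiteFunction α x) (Φ x)) : Φ ∈ pilipovicFunctions d :=
  ⟨hΦ, fun η hη => ⟨_, fun N x => norm_harmonicPower_le hΦ hη (hc η hη).hasSum h N x⟩⟩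

theorem hasSum_single_mul {d : ℕ} (α : Fin d → ℕ) (g : (Fin d → ℕ) → ℝ) :
    HasSum (fun β => ‖(Pi.single α 1 : (Fin d → ℕ) → ℂ) β‖ * g β) (g α) := by
  convert! hasSum_single α fun β hβ => ?_
  · simp
  · simp [hβ]

theorem hasSum_single_mul_hermiteFunction {d : ℕ} (α : Fin d → ℕ) (x : RSpace d) :
    HasSum (fun β => (Pi.single α 1 : (Fin d → ℕ) → ℂ) β * hermiteFunction β x)
      (hermiteFunction α x) := by
  convert! hasSum_single α fun β hβ => ?_
  · simp
  · simp [hβ]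

theorem hermiteFunction_mem_pilipovicFunctions {d : ℕ} (α : Fin d → ℕ) :
    hermiteFunction α ∈ pilipovicFunctions d :=
  mem_pilipovicFunctions_of_hasSum (contDiff_hermiteFunction α)
    (fun η _ => (hasSum_single_mul α (pilipovicWeight η)).summable)
    (hasSum_single_mul_hermiteFunction α)

/-! ### Gaussian windows as Hermite series, and the action of distributions on them. -/

/-- The generating function of the Hermite functions. -/
noncomputable def gaussianAtom {d : ℕ} (w : CSpace d) (x : RSpace d) : ℂ :=
  ∏ j, hermiteGenerating (w j) (x j)

theorem contDiff_gaussianAtom {d : ℕ} (w : CSpace d) : ContDiff ℝ (⊤ : ℕ∞) (gaussianAtom w) := by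
  refine contDiff_prod_apply (g := fun j => hermiteGenerating (w j)) fun j => ?_
  unfold hermiteGenerating
  fun_prop

theorem hasSum_gaussianAtom {d : ℕ} (w : CSpace d) (x : RSpace d) :
    HasSum (fun α => monomialE α w * hermiteFunction α x) (gaussianAtom w x) := by
  have h := hasSum_prod_multiIndex
    (f := fun j n => w j ^ n / (√(n ! : ℝ) : ℂ) * complexHermite n (x j))
    (s := fun j => hermiteGenerating (w j) (x j)) (fun j => ?_)
    fun j => hasSum_hermiteGenerating (w j) (x j)
  · refine h.congr_fun fun α => ?_
    rw [Finset.prod_mul_distrib, ← hermiteFunction_eq_prod, Finset.prod_div_distrib, monomialE,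
      sqrt_multiFactorial, Complex.ofReal_prod]
  · refine Summable.of_nonneg_of_le (fun _ => norm_nonneg _) (fun n => ?_)
      ((summable_pow_div_sqrt_factorial (‖w j‖ * Real.exp 2)).mul_right (Real.exp 4))
    have h0 : ‖complexHermite n (x j)‖ ≤ Real.exp (2 * n + 4) := by
      simpa using norm_iteratedDeriv_complexHermite_le n 0 (x j)
    rw [norm_mul, norm_div, norm_pow, Complex.norm_real, Real.norm_of_nonneg (Real.sqrt_nonneg _)]
    calc _ ≤ ‖w j‖ ^ n / √(n ! : ℝ) * Real.exp (2 * n + 4) := by gcongr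
      _ = _ := by
        rw [Real.exp_add, mul_comm 2 (n : ℝ), Real.exp_nat_mul, mul_pow]
        ring

theorem pilipovicWeight_eq {d : ℕ} (η : ℝ) (α : Fin d → ℕ) :
    pilipovicWeight η α =
      Real.exp (d / η + 4 * d) * Real.exp (2 / η + 2) ^ multiLength α := by
  rw [pilipovicWeight, harmonicEigenvalue, hermiteBound, ← Real.exp_nat_mul, ← Real.exp_add,
    ← Real.exp_add]
  congr 1
  ring

theorem summable_norm_monomialE_mul_pilipovicWeight {d : ℕ} (w : CSpace d) (η : ℝ) :
    Summable fun α => ‖monomialE α w‖ * pilipovicWeight η α := by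
  refine Summable.of_nonneg_of_le (fun α => mul_nonneg (norm_nonneg _) ?_) (fun α => ?_)
    ((summable_pow_multiLength_div_sqrt (d := d) (‖w‖ * Real.exp (2 / η + 2))).mul_left
      (Real.exp (d / η + 4 * d)))
  · rw [pilipovicWeight_eq]
    positivity
  · rw [pilipovicWeight_eq]
    calc _ ≤ ‖w‖ ^ multiLength α / √(multiFactorial α : ℝ) *
          (Real.exp (d / η + 4 * d) * Real.exp (2 / η + 2) ^ multiLength α) := by
          gcongr
          exact norm_monomialE_le α le_rfl
      _ = _ := by rw [mul_pow]; ring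

theorem gaussianAtom_mem_pilipovicFunctions {d : ℕ} (w : CSpace d) :
    gaussianAtom w ∈ pilipovicFunctions d :=
  mem_pilipovicFunctions_of_hasSum (contDiff_gaussianAtom w)
    (fun η _ => summable_norm_monomialE_mul_pilipovicWeight w η) (hasSum_gaussianAtom w)

theorem withSeminorms_pilipovicSeminorm (d : ℕ) : WithSeminorms (pilipovicSeminorm d) := ⟨rfl⟩

/-- A distribution is bounded by one of the norms of the Pilipović space. -/
theorem PilipovicDistribution.exists_bound {d : ℕ} (f : PilipovicDistribution d) :
    ∃ η : ℝ, 0 < η ∧ ∃ D : ℝ, 0 ≤ D ∧ ∀ (g : PilipovicSpace d) (T : ℝ),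
      (∀ N x, ‖harmonicPower N g.toFun x‖ ≤ T * (η ^ N * N !)) → ‖f g‖ ≤ D * T := by
  obtain ⟨s, C, -, hC⟩ := Seminorm.bound_of_continuous (withSeminorms_pilipovicSeminorm d)
    ((normSeminorm ℂ ℂ).comp f.toLinearMap) (continuous_norm.comp f.continuous)
  -- The norms decrease in h, so the smallest parameter controls the finite family; any η serves an
  -- empty one.
  obtain ⟨η, hη, hηs⟩ : ∃ η : ℝ, 0 < η ∧ ∀ h ∈ s, η ≤ h.1 := by
    rcases s.eq_empty_or_nonempty with rfl | hs
    · exact ⟨1, one_pos, by simp⟩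
    · exact ⟨(s.min' hs).1, (s.min' hs).2, fun h hh => s.min'_le h hh⟩
  refine ⟨η, hη, C, C.2, fun g T hT => ?_⟩
  have hT0 : 0 ≤ T := by
    have := (norm_nonneg _).trans (hT 0 0)
    simpa using this
  refine (hC g).trans ?_
  rw [smul_apply, NNReal.smul_def, smul_eq_mul]
  refine mul_le_mul_of_nonneg_left (Seminorm.finset_sup_apply_le hT0 fun h hh => ?_) C.2
  refine ciSup_le fun q => ?_
  have hpos : 0 < h.1 ^ q.1 * (q.1 ! : ℝ) := by
    have := h.2
    positivity
  rw [div_le_iff₀ hpos]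
  refine (hT q.1 q.2).trans ?_
  gcongr
  exact hηs h hh

theorem pairing_of_mem {d : ℕ} (f : PilipovicDistribution d) {g : RSpace d → ℂ}
    (hg : g ∈ pilipovicFunctions d) : pairing f g = f (PilipovicSpace.ofMem g hg) := by
  rw [pairing, dif_pos hg]

theorem pairing_smul {d : ℕ} (f : PilipovicDistribution d) (k : ℂ) {g : RSpace d → ℂ}
    (hg : g ∈ pilipovicFunctions d) : pairing f (k • g) = k * pairing f g := by
  rw [pairing_of_mem f hg, pairing_of_mem f ((pilipovicFunctions d).smul_mem k hg)]
  exact map_smul f k (PilipovicSpace.ofMem g hg)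

/-- The Hermite coefficients of a distribution grow at most exponentially. -/
theorem exists_norm_hermiteSeries_le {d : ℕ} (f : PilipovicDistribution d) :
    ∃ C A : ℝ, 0 ≤ C ∧ 0 ≤ A ∧ ∀ α, ‖hermiteSeries f α‖ ≤ C * A ^ multiLength α := by
  obtain ⟨η, hη, D, hD, hf⟩ := f.exists_bound
  refine ⟨D * Real.exp (d / η + 4 * d), Real.exp (2 / η + 2), by positivity, by positivity,
    fun α => ?_⟩
  rw [hermiteSeries, pairing_of_mem f (hermiteFunction_mem_pilipovicFunctions α), mul_assoc,
    ← pilipovicWeight_eq]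
  exact hf _ _ fun N x => norm_harmonicPower_le (contDiff_hermiteFunction α) hη
    (hasSum_single_mul α _) (hasSum_single_mul_hermiteFunction α) N x

theorem summable_hermiteSeries_mul_monomialE {d : ℕ} (f : PilipovicDistribution d)
    (z : CSpace d) : Summable fun α => hermiteSeries f α * monomialE α z := by
  obtain ⟨C, A, -, -, h⟩ := exists_norm_hermiteSeries_le f
  exact (summable_norm_mul_monomialE h z).of_norm

theorem hasSum_ite_mem_finset {ι M : Type*} [AddCommGroup M] [TopologicalSpace M]
    [IsTopologicalAddGroup M] [DecidableEq ι] {g : ι → M} {T : M} (hg : HasSum g T)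
    (S : Finset ι) : HasSum (fun i => if i ∈ S then 0 else g i) (T - ∑ i ∈ S, g i) := by
  have h := hg.sub (hasSum_sum_of_ne_finset_zero (f := fun i => if i ∈ S then g i else 0) (s := S)
    fun i hi => if_neg hi)
  rw [Finset.sum_congr rfl fun i hi => if_pos hi] at h
  refine h.congr_fun fun i => ?_
  split_ifs <;> simp

/-- The Bargmann transform is the pairing with the generating function of the Hermite functions. -/
theorem pairing_gaussianAtom {d : ℕ} (f : PilipovicDistribution d) (w : CSpace d) :
    pairing f (gaussianAtom w) = bargmannTransform (hermiteSeries f) w := by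
  obtain ⟨η, hη, D, hD, hf⟩ := f.exists_bound
  have hw := gaussianAtom_mem_pilipovicFunctions w
  let G := PilipovicSpace.ofMem _ hw
  let H : (Fin d → ℕ) → PilipovicSpace d := fun α =>
    PilipovicSpace.ofMem _ (hermiteFunction_mem_pilipovicFunctions α)
  have hE := (summable_norm_monomialE_mul_pilipovicWeight w η).hasSum
  set T := ∑' α, ‖monomialE α w‖ * pilipovicWeight η α with hT
  -- The remainder is the Hermite series with the coefficients in S set to zero, so its image under
  -- f is bounded by the tail of a convergent series.
  have hrem : ∀ S : Finset (Fin d → ℕ), ‖f (G - ∑ α ∈ S, monomialE α w • H α)‖ ≤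
      D * (T - ∑ α ∈ S, ‖monomialE α w‖ * pilipovicWeight η α) := by
    intro S
    let g := G - ∑ α ∈ S, monomialE α w • H α
    have hfun : ∀ x, g.toFun x = gaussianAtom w x - ∑ α ∈ S, monomialE α w * hermiteFunction α x := by
      intro x
      let ev : PilipovicSpace d →ₗ[ℂ] ℂ :=
        (LinearMap.proj x).comp (pilipovicFunctions d).subtype
      change ev g = _
      rw [map_sub, map_sum]
      rfl
    refine hf g _ fun N x => norm_harmonicPower_le (Φ := g.toFun) g.2.1 hη
      (c := fun α => if α ∈ S then 0 else monomialE α w) ?_ (fun x => ?_) N x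
    · refine (hasSum_ite_mem_finset hE S).congr_fun fun α => ?_
      split_ifs <;> simp
    · rw [hfun]
      refine (hasSum_ite_mem_finset (hasSum_gaussianAtom w x) S).congr_fun fun α => ?_
      split_ifs <;> simp
  have hlim : HasSum (fun α => monomialE α w * f (H α)) (f G) := by
    rw [HasSum, SummationFilter.unconditional_filter, tendsto_iff_norm_sub_tendsto_zero]
    have h0 : Filter.Tendsto (fun S : Finset (Fin d → ℕ) =>
        D * (T - ∑ α ∈ S, ‖monomialE α w‖ * pilipovicWeight η α)) Filter.atTop (nhds 0) := by
      have := (hE.const_sub T).const_mul D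
      simpa using this
    refine squeeze_zero (fun _ => norm_nonneg _) (fun S => ?_) h0
    rw [norm_sub_rev]
    refine le_trans (le_of_eq ?_) (hrem S)
    rw [map_sub, map_sum]
    simp
  rw [pairing_of_mem f hw, ← hlim.tsum_eq, bargmannTransform]
  refine tsum_congr fun α => ?_
  rw [hermiteSeries, pairing_of_mem f (hermiteFunction_mem_pilipovicFunctions α), mul_comm]

/-! ### The short-time Fourier transform in terms of the Bargmann transform. -/

/-- The point `(x - iξ)/√2`. -/
noncomputable def phaseToComplex {d : ℕ} (x ξ : RSpace d) : CSpace d :=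
  WithLp.toLp 2 fun j => ((x j : ℂ) - Complex.I * ξ j) / √2

/-- Coordinate by coordinate, this compares exponents of Gaussians in y. The modulus of the scalar
is the inverse of the Gaussian factor in ω_R, so the two cancel in condition 3. -/
theorem stftAtom_eq_smul_gaussianAtom {d : ℕ} (x ξ : RSpace d) :
    stftAtom x ξ = Complex.exp (-(‖x‖ ^ 2 + ‖ξ‖ ^ 2) / 4 - Complex.I * (⟪x, ξ⟫_ℝ : ℂ) / 2) •
      gaussianAtom (phaseToComplex x ξ) := by
  have h2 : ((√2 : ℝ) : ℂ) ≠ 0 := by exact_mod_cast (by positivity : √(2 : ℝ) ≠ 0)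
  have h22 : ((√2 : ℝ) : ℂ) ^ 2 = 2 := by
    exact_mod_cast Real.sq_sqrt (show (0 : ℝ) ≤ 2 by norm_num)
  have hgen : ∀ (y : RSpace d) (j : Fin d),
      hermiteGenerating (phaseToComplex x ξ j) (y j) = ((Real.pi ^ (-(1 : ℝ) / 4) : ℝ) : ℂ) *
        Complex.exp (-(y j : ℂ) ^ 2 / 2 + ((x j : ℂ) - Complex.I * ξ j) * y j -
          ((x j : ℂ) - Complex.I * ξ j) ^ 2 / 4) := fun y j => by
    rw [hermiteGenerating]
    congr 2
    simp only [phaseToComplex]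
    rw [mul_div_cancel₀ _ h2, div_pow, h22]
    ring
  funext y
  rw [Pi.smul_apply, smul_eq_mul, gaussianAtom, Finset.prod_congr rfl fun j _ => hgen y j,
    Finset.prod_mul_distrib, Finset.prod_const, Finset.card_univ, Fintype.card_fin,
    ← Complex.exp_sum, mul_left_comm, ← Complex.exp_add, stftAtom, gaussianWindow,
    Complex.conj_ofReal, Complex.ofReal_mul, mul_assoc, Complex.ofReal_exp, ← Complex.exp_add]
  congr 1
  · rw [← Complex.ofReal_pow, ← Real.rpow_mul_natCast Real.pi_pos.le]
    congr 2
    ring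
  · congr 1
    push_cast
    have hn : ∀ v : RSpace d, (‖v‖ : ℂ) ^ 2 = ∑ j, (v j : ℂ) ^ 2 := fun v => by
      rw [← Complex.ofReal_pow, EuclideanSpace.real_norm_sq_eq]
      push_cast
      rfl
    have hi : ∀ u v : RSpace d, (⟪u, v⟫_ℝ : ℂ) = ∑ j, (u j : ℂ) * v j := fun u v => by
      rw [PiLp.inner_apply]
      push_cast
      exact Finset.sum_congr rfl fun j _ => by simp [mul_comm]
    rw [hn, hn, hn, hi, hi]
    simp only [neg_div, Finset.mul_sum, Finset.sum_div, ← Finset.sum_neg_distrib,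
      ← Finset.sum_add_distrib, ← Finset.sum_sub_distrib]
    refine Finset.sum_congr rfl fun j _ => ?_
    simp only [PiLp.sub_apply]
    push_cast
    have hI := Complex.I_sq
    linear_combination ((ξ j : ℂ) ^ 2 / 4) * hI

theorem stftAtom_mem_pilipovicFunctions {d : ℕ} (x ξ : RSpace d) :
    stftAtom x ξ ∈ pilipovicFunctions d := by
  rw [stftAtom_eq_smul_gaussianAtom]
  exact (pilipovicFunctions d).smul_mem _ (gaussianAtom_mem_pilipovicFunctions _)

theorem norm_stft {d : ℕ} (f : PilipovicDistribution d) (x ξ : RSpace d) :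
    ‖stft f x ξ‖ = (2 * Real.pi) ^ (-(d : ℝ) / 2) * (Real.exp (-(‖x‖ ^ 2 + ‖ξ‖ ^ 2) / 4) *
      ‖bargmannTransform (hermiteSeries f) (phaseToComplex x ξ)‖) := by
  rw [stft, stftAtom_eq_smul_gaussianAtom, pairing_smul f _ (gaussianAtom_mem_pilipovicFunctions _),
    pairing_gaussianAtom, norm_mul, norm_mul, Complex.norm_real,
    Real.norm_of_nonneg (by positivity), Complex.norm_exp]
  congr 3
  have : (-((‖x‖ : ℂ) ^ 2 + (‖ξ‖ : ℂ) ^ 2) / 4 - Complex.I * (⟪x, ξ⟫_ℝ : ℂ) / 2) =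
      ((-(‖x‖ ^ 2 + ‖ξ‖ ^ 2) / 4 : ℝ) : ℂ) + ((-⟪x, ξ⟫_ℝ / 2 : ℝ) : ℂ) * Complex.I := by
    push_cast
    ring
  rw [this]
  simp [-Complex.ofReal_div]

theorem norm_stft_mul_weightOmega {d : ℕ} (f : PilipovicDistribution d) (R : ℝ)
    (X : PhaseSpace d) :
    ‖stft f X.pos X.freq * (weightOmega R X : ℂ)‖ = (2 * Real.pi) ^ (-(d : ℝ) / 2) *
      (‖bargmannTransform (hermiteSeries f) (phaseToComplex X.pos X.freq)‖ *
        Real.exp (-R * (‖X.pos‖ + ‖X.freq‖))) := by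
  have h : Real.exp (-(‖X.pos‖ ^ 2 + ‖X.freq‖ ^ 2) / 4) *
      Real.exp ((‖X.pos‖ ^ 2 + ‖X.freq‖ ^ 2) / 4) = 1 := by
    rw [← Real.exp_add, ← Real.exp_zero]
    congr 1
    ring
  rw [norm_mul, norm_stft, Complex.norm_real, weightOmega, Real.norm_of_nonneg (by positivity)]
  linear_combination (2 * Real.pi) ^ (-(d : ℝ) / 2) *
    ‖bargmannTransform (hermiteSeries f) (phaseToComplex X.pos X.freq)‖ *
      Real.exp (-R * (‖X.pos‖ + ‖X.freq‖)) * h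

theorem norm_phaseToComplex_sq {d : ℕ} (x ξ : RSpace d) :
    ‖phaseToComplex x ξ‖ ^ 2 = (‖x‖ ^ 2 + ‖ξ‖ ^ 2) / 2 := by
  rw [EuclideanSpace.norm_sq_eq, EuclideanSpace.real_norm_sq_eq, EuclideanSpace.real_norm_sq_eq,
    ← Finset.sum_add_distrib, Finset.sum_div]
  refine Finset.sum_congr rfl fun j _ => ?_
  simp only [phaseToComplex]
  rw [norm_div, div_pow, Complex.norm_real, Real.norm_of_nonneg (Real.sqrt_nonneg _),
    Real.sq_sqrt (by norm_num), Complex.sq_norm, Complex.normSq_apply]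
  simp
  ring

theorem norm_phaseSpace_sq {d : ℕ} (X : PhaseSpace d) :
    ‖X‖ ^ 2 = ‖X.pos‖ ^ 2 + ‖X.freq‖ ^ 2 := by
  rw [EuclideanSpace.real_norm_sq_eq, EuclideanSpace.real_norm_sq_eq,
    EuclideanSpace.real_norm_sq_eq, Fintype.sum_sum_type]
  rfl

/-! ### From small-ball estimates to exponential type. -/

/-- Under an estimate for the size of `F` on small balls, a bound `e^{m(|z|)}` for an entire
function `F` improves. -/
theorem norm_le_exp_of_small_ball_estimate {d : ℕ} {F : CSpace d → ℂ} (hF : Differentiable ℂ F)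
    {K R N : ℝ} (hK : 1 ≤ K) (hN : 0 ≤ N)
    (hball : ∀ (z : CSpace d) (ε t : ℝ), 0 < ε → ε ≤ 1 → 0 ≤ t →
      (∀ w, ‖w - z‖ < ε → t ≤ ‖F w‖) → t * ε ^ N ≤ K * Real.exp (R * ‖z‖))
    {m : ℝ → ℝ} (hm : MonotoneOn m (Ici 0)) (hFm : ∀ z, ‖F z‖ ≤ Real.exp (m ‖z‖)) (z : CSpace d) :
    ‖F z‖ ≤ Real.exp ((Real.log 2 + Real.log K / (1 + N)) + R / (1 + N) * ‖z‖
      + N / (1 + N) * m (‖z‖ + 2)) := by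
  rcases eq_or_ne (F z) 0 with h0 | h0
  · rw [h0, norm_zero]
    positivity
  set M := m (‖z‖ + 2) with hM
  have hFM : ∀ u, ‖u - z‖ ≤ 2 → ‖F u‖ ≤ Real.exp M := fun u hu => by
    refine (hFm u).trans (Real.exp_le_exp.2 (hm (norm_nonneg _) (by
      simp only [mem_Ici]; positivity) ?_))
    linarith [norm_sub_norm_le u z]
  set L := Real.log ‖F z‖ with hL
  have hFL : ‖F z‖ = Real.exp L := (Real.exp_log (norm_pos_iff.2 h0)).symm
  have hLM : L ≤ M := by
    have := hFM z (by simp)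
    rwa [hFL, Real.exp_le_exp] at this
  have hlog2 : 0 < Real.log 2 := Real.log_pos one_lt_two
  have hε1 : Real.exp (L - Real.log 2 - M) ≤ 1 := Real.exp_le_one_iff.2 (by linarith)
  -- The level is t = |F(z)|/2 and the radius is ε = t/e^M. As F is e^M-Lipschitz on the unit ball
  -- about z, it varies by at most t there. The shift by 2 in M is one unit for this ball and one
  -- for Cauchy's estimate at its points.
  have key := hball z (Real.exp (L - Real.log 2 - M)) (Real.exp (L - Real.log 2)) (Real.exp_pos _)
    hε1 (Real.exp_pos _).le fun w hw => by
      have hlip := (convex_ball z 1).norm_image_sub_le_of_norm_fderiv_le (𝕜 := ℂ) (f := F)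
        (C := Real.exp M) (x := z) (y := w) (fun u _ => hF u) (fun u hu => ?_)
        (Metric.mem_ball_self one_pos) (by
          rw [Metric.mem_ball, dist_eq_norm]
          linarith)
      · have h1 : ‖F z‖ - ‖F w‖ ≤ ‖F w - F z‖ := by
          rw [norm_sub_rev]
          exact norm_sub_norm_le _ _
        have h2 : Real.exp M * ‖w - z‖ ≤ Real.exp (L - Real.log 2) := by
          calc Real.exp M * ‖w - z‖ ≤ Real.exp M * Real.exp (L - Real.log 2 - M) := by gcongr
            _ = _ := by rw [← Real.exp_add]; ring_nf
        have h3 : Real.exp L = 2 * Real.exp (L - Real.log 2) := by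
          rw [Real.exp_sub, Real.exp_log two_pos]
          ring
        linarith
      · refine norm_fderiv_le_of_norm_le_on_closedBall hF fun v hv => hFM v ?_
        rw [Metric.mem_ball, dist_eq_norm] at hu
        have := norm_sub_le_norm_sub_add_norm_sub v u z
        linarith
  rw [← Real.exp_mul, ← Real.exp_add, ← Real.exp_log (show 0 < K by linarith), ← Real.exp_add,
    Real.exp_le_exp] at key
  rw [hFL, Real.exp_le_exp]
  have h1N : 0 < 1 + N := by linarith
  have : Real.log 2 + Real.log K / (1 + N) + R / (1 + N) * ‖z‖ + N / (1 + N) * M =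
      Real.log 2 + (Real.log K + R * ‖z‖ + N * M) / (1 + N) := by
    field_simp
    ring
  rw [this, ← sub_le_iff_le_add', le_div_iff₀ h1N]
  linarith

theorem tendsto_pow_mul_sq_zero {θ : ℝ} (h0 : 0 ≤ θ) (h1 : θ < 1) (C ρ : ℝ) :
    Filter.Tendsto (fun k : ℕ => θ ^ k * (C * (1 + ρ + 2 * k) ^ 2)) Filter.atTop (nhds 0) := by
  have ha : |θ| < 1 := by rwa [abs_of_nonneg h0]
  have t0 := (tendsto_pow_const_mul_const_pow_of_abs_lt_one 0 ha).const_mul (C * (1 + ρ) ^ 2)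
  have t1 := (tendsto_pow_const_mul_const_pow_of_abs_lt_one 1 ha).const_mul (C * 4 * (1 + ρ))
  have t2 := (tendsto_pow_const_mul_const_pow_of_abs_lt_one 2 ha).const_mul (C * 4)
  have := (t0.add t1).add t2
  simp only [mul_zero, add_zero] at this
  refine this.congr fun k => ?_
  ring

/-- An entire function of order two that satisfies an estimate on small balls is of exponential
type. -/
theorem exists_exponential_type_of_small_ball_estimate {d : ℕ} {F : CSpace d → ℂ}
    (hF : Differentiable ℂ F) {C : ℝ} (hC : 0 ≤ C)
    (hFC : ∀ z, ‖F z‖ ≤ Real.exp (C * (1 + ‖z‖) ^ 2))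
    {K R N : ℝ} (hR : 0 ≤ R) (hN : 0 ≤ N)
    (hball : ∀ (z : CSpace d) (ε t : ℝ), 0 < ε → ε ≤ 1 → 0 ≤ t →
      (∀ w, ‖w - z‖ < ε → t ≤ ‖F w‖) → t * ε ^ N ≤ K * Real.exp (R * ‖z‖)) :
    F ∈ AFlat d := by
  set K' := max K 1 with hK'
  have hK'1 : 1 ≤ K' := le_max_right _ _
  have hball' : ∀ (z : CSpace d) (ε t : ℝ), 0 < ε → ε ≤ 1 → 0 ≤ t →
      (∀ w, ‖w - z‖ < ε → t ≤ ‖F w‖) → t * ε ^ N ≤ K' * Real.exp (R * ‖z‖) :=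
    fun z ε t h1 h2 h3 h4 => (hball z ε t h1 h2 h3 h4).trans (by
      gcongr
      exact le_max_left _ _)
  have h1N : 0 < 1 + N := by linarith
  set θ := N / (1 + N) with hθ
  have hθ0 : 0 ≤ θ := by positivity
  have hθ1 : θ < 1 := (div_lt_one h1N).2 (by linarith)
  have h1θ : 0 < 1 - θ := by linarith
  set a := Real.log 2 + Real.log K' / (1 + N) with ha
  set b := R / (1 + N) with hb
  have ha0 : 0 ≤ a := by
    have := Real.log_nonneg hK'1
    have := Real.log_nonneg one_le_two
    positivity
  have hb0 : 0 ≤ b := by positivity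
  -- A + Bρ is the fixed point of the map m ↦ a + bρ + θ m(ρ + 2) on affine functions; only the
  -- quadratic excess changes in the iteration.
  set B := b / (1 - θ) with hB
  set A := (a + 2 * θ * B) / (1 - θ) with hA
  have hB0 : 0 ≤ B := by positivity
  have hA0 : 0 ≤ A := by positivity
  have hBeq : b + θ * B = B := by
    rw [hB]
    field_simp
    ring
  have hAeq : a + θ * (A + 2 * B) = A := by
    have : A * (1 - θ) = a + 2 * θ * B := by rw [hA]; field_simp
    linarith
  have hiter : ∀ (k : ℕ) (z : CSpace d),
      ‖F z‖ ≤ Real.exp (A + B * ‖z‖ + θ ^ k * (C * (1 + ‖z‖ + 2 * k) ^ 2)) := by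
    intro k
    induction k with
    | zero =>
      intro z
      refine (hFC z).trans (Real.exp_le_exp.2 ?_)
      have : 0 ≤ A + B * ‖z‖ := by positivity
      simpa using this
    | succ k ih =>
      intro z
      have hm : MonotoneOn (fun ρ : ℝ => A + B * ρ + θ ^ k * (C * (1 + ρ + 2 * k) ^ 2)) (Ici 0) := by
        intro x hx y _ hxy
        simp only [mem_Ici] at hx
        have : 0 ≤ 1 + x + 2 * k := by positivity
        dsimp only
        gcongr
      refine (norm_le_exp_of_small_ball_estimate hF hK'1 hN hball' hm ih z).trans
        (Real.exp_le_exp.2 (le_of_eq ?_))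
      push_cast
      -- Replacing ρ by ρ + 2 in 1 + ρ + 2k is the same as raising k by one.
      linear_combination hAeq + ‖z‖ * hBeq
  have hlim : ∀ z : CSpace d, ‖F z‖ ≤ Real.exp (A + B * ‖z‖) := fun z => by
    have h := ((tendsto_pow_mul_sq_zero hθ0 hθ1 C ‖z‖).const_add (A + B * ‖z‖)).rexp
    rw [add_zero] at h
    exact ge_of_tendsto' h fun k => hiter k z
  refine ⟨hF, B + 1, by positivity, Real.exp A, fun z => (hlim z).trans ?_⟩
  rw [← Real.exp_add]
  gcongr
  linarith

theorem exists_norm_bargmannTransform_hermiteSeries_le {d : ℕ} (f : PilipovicDistribution d) :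
    ∃ C : ℝ, 0 ≤ C ∧
      ∀ z, ‖bargmannTransform (hermiteSeries f) z‖ ≤ Real.exp (C * (1 + ‖z‖) ^ 2) := by
  obtain ⟨C, A, hC, hA, h⟩ := exists_norm_hermiteSeries_le f
  refine ⟨C + d + 4 * d * A ^ 2, by positivity, fun z => ?_⟩
  refine (norm_bargmannTransform_le hC hA h z).trans ?_
  have h1 : C ≤ Real.exp C := by linarith [Real.add_one_le_exp C]
  have h2 : (2 : ℝ) ≤ Real.exp 1 := by linarith [Real.add_one_le_exp (1 : ℝ)]
  calc C * (2 * Real.exp ((2 * (A * ‖z‖)) ^ 2)) ^ d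
      ≤ Real.exp C * (Real.exp 1 * Real.exp ((2 * (A * ‖z‖)) ^ 2)) ^ d := by gcongr
    _ = Real.exp (C * 1 + d * 1 + 4 * d * A ^ 2 * ‖z‖ ^ 2) := by
        rw [← Real.exp_add, ← Real.exp_nat_mul, ← Real.exp_add]
        ring_nf
    _ ≤ Real.exp (C * (1 + ‖z‖) ^ 2 + d * (1 + ‖z‖) ^ 2 + 4 * d * A ^ 2 * (1 + ‖z‖) ^ 2) := by
        have h3 : 1 ≤ (1 + ‖z‖) ^ 2 := by nlinarith [norm_nonneg z]
        have h4 : ‖z‖ ^ 2 ≤ (1 + ‖z‖) ^ 2 := by nlinarith [norm_nonneg z]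
        gcongr
    _ = _ := by ring_nf

theorem differentiable_bargmannTransform_hermiteSeries {d : ℕ} (f : PilipovicDistribution d) :
    Differentiable ℂ (bargmannTransform (hermiteSeries f)) := by
  obtain ⟨C, A, hC, hA, h⟩ := exists_norm_hermiteSeries_le f
  exact differentiable_bargmannTransform hC hA h

theorem hermiteSeries_mem_HFlat {d : ℕ} {f : PilipovicDistribution d}
    (h : bargmannTransform (hermiteSeries f) ∈ AFlat d) : hermiteSeries f ∈ HFlat d := by
  obtain ⟨c, hc, hcf⟩ := exists_mem_HFlat_of_mem_AFlat h
  obtain ⟨R, hR, C, hC⟩ := hc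
  rw [← eq_of_bargmannTransform_eq (fun z =>
    (summable_norm_mul_monomialE (norm_le_of_mem_HFlat_bound hR hC) z).of_norm)
    (summable_hermiteSeries_mul_monomialE f) hcf]
  exact ⟨R, hR, C, hC⟩

theorem hermiteSeries_mem_HFlat_of_small_ball_estimate {d : ℕ} {f : PilipovicDistribution d}
    {K R N : ℝ} (hR : 0 ≤ R) (hN : 0 ≤ N)
    (hball : ∀ (z : CSpace d) (ε t : ℝ), 0 < ε → ε ≤ 1 → 0 ≤ t →
      (∀ w, ‖w - z‖ < ε → t ≤ ‖bargmannTransform (hermiteSeries f) w‖) →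
        t * ε ^ N ≤ K * Real.exp (R * ‖z‖)) :
    hermiteSeries f ∈ HFlat d := by
  obtain ⟨C, hC, h⟩ := exists_norm_bargmannTransform_hermiteSeries_le f
  exact hermiteSeries_mem_HFlat (exists_exponential_type_of_small_ball_estimate
    (differentiable_bargmannTransform_hermiteSeries f) hC h hR hN hball)

/-! ### Upper and lower bounds for L^p and iterated quasi-norms. -/

/-- Comparison with a constant on s, which asks no measurability of g. For p = ∞ the exponent 1 /
p.toReal is 0, and the positive measure of s is what makes the bound true. -/
theorem mul_measure_rpow_le_eLpNorm {X : Type*} [MeasurableSpace X] {μ : Measure X} {p T : ℝ≥0∞}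
    (hp : p ≠ 0) {s : Set X} (hs : MeasurableSet s) (hμ : μ s ≠ 0) {ε : Type*} [TopologicalSpace ε]
    [ContinuousENorm ε] {g : X → ε} (h : ∀ x ∈ s, T ≤ ‖g x‖ₑ) :
    T * μ s ^ (1 / p.toReal) ≤ eLpNorm g p μ := by
  rw [← enorm_eq_self T, ← eLpNorm_indicator_const' hs hμ hp]
  refine eLpNorm_mono_enorm fun x => ?_
  by_cases hx : x ∈ s
  · simpa [hx] using h x hx
  · simp [hx]

section HaarMeasure

variable {E : Type*} [NormedAddCommGroup E] [NormedSpace ℝ E] [FiniteDimensional ℝ E]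
  [MeasurableSpace E] [BorelSpace E]

theorem exists_le_addHaar_ball_rpow (μ : Measure E) [μ.IsAddHaarMeasure] (p : ℝ≥0∞) :
    ∃ κ N : ℝ, 0 < κ ∧ 0 ≤ N ∧ ∀ (a : E) (ε : ℝ), 0 < ε →
      ENNReal.ofReal (κ * ε ^ N) ≤ μ (Metric.ball a ε) ^ (1 / p.toReal) := by
  have h0 : 0 < (μ (Metric.ball 0 1)).toReal :=
    ENNReal.toReal_pos (Metric.measure_ball_pos μ 0 one_pos).ne' measure_ball_lt_top.ne
  refine ⟨(μ (Metric.ball 0 1)).toReal ^ (1 / p.toReal), Module.finrank ℝ E * (1 / p.toReal),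
    by positivity, by positivity, fun a ε hε => le_of_eq ?_⟩
  rw [Measure.addHaar_ball_of_pos μ a hε, ENNReal.mul_rpow_of_nonneg _ _ (by positivity),
    ENNReal.ofReal_mul (by positivity), mul_comm, Real.rpow_mul hε.le, Real.rpow_natCast,
    ← ENNReal.ofReal_rpow_of_nonneg (by positivity) (by positivity),
    ← ENNReal.ofReal_rpow_of_nonneg (by positivity) (by positivity),
    ENNReal.ofReal_toReal measure_ball_lt_top.ne]

theorem integrable_exp_neg_mul_norm (μ : Measure E) [μ.IsAddHaarMeasure] {c : ℝ} (hc : 0 < c) :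
    Integrable (fun x : E => Real.exp (-c * ‖x‖)) μ := by
  set r : ℕ := Module.finrank ℝ E + 1
  have h := (integrable_one_add_norm (E := E) (μ := μ) (r := (r : ℝ)) (by simp [r])).const_mul
    (r ! * Real.exp c / c ^ r)
  refine h.mono' (by fun_prop) (Filter.Eventually.of_forall fun x => ?_)
  have h1 := Real.pow_div_factorial_le_exp (x := c * (1 + ‖x‖)) (by positivity) r
  rw [Real.norm_of_nonneg (Real.exp_pos _).le, Real.rpow_neg (by positivity), Real.rpow_natCast,
    neg_mul, Real.exp_neg, ← div_eq_mul_inv, div_div, inv_eq_one_div,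
    div_le_div_iff₀ (by positivity) (by positivity)]
  rw [div_le_iff₀ (by positivity), mul_pow, mul_add, mul_one, Real.exp_add] at h1
  linarith

theorem eLpNorm_exp_neg_mul_norm_lt_top (μ : Measure E) [μ.IsAddHaarMeasure] {c : ℝ} (hc : 0 < c)
    (p : ℝ≥0∞) : eLpNorm (fun x : E => Real.exp (-c * ‖x‖)) p μ < ∞ := by
  have hm : AEStronglyMeasurable (fun x : E => Real.exp (-c * ‖x‖)) μ := by fun_prop
  rcases eq_or_ne p 0 with rfl | h0
  · simp
  rcases eq_or_ne p ∞ with rfl | htop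
  · refine (memLp_top_of_bound hm 1 (Filter.Eventually.of_forall fun x => ?_)).2
    rw [Real.norm_of_nonneg (Real.exp_pos _).le, Real.exp_le_one_iff]
    have := norm_nonneg x
    nlinarith
  · refine ((integrable_norm_rpow_iff hm h0 htop).1 ?_).2
    have h := integrable_exp_neg_mul_norm μ (mul_pos hc (ENNReal.toReal_pos h0 htop))
    refine h.congr (Filter.Eventually.of_forall fun x => ?_)
    simp only [Real.norm_of_nonneg (Real.exp_pos _).le]
    rw [← Real.exp_mul]
    ring_nf

end HaarMeasure

section IteratedNorm

variable {E : Type} [NormedAddCommGroup E] [InnerProductSpace ℝ E] [FiniteDimensional ℝ E]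
  [MeasurableSpace E] [BorelSpace E]

/-- Each integration over a ball of radius ε in one factor contributes a power of ε, and the powers
add up. The constants do not depend on the centre a. -/
theorem exists_le_iteratedLpNorm : ∀ (n : ℕ) (p : Fin n → ℝ≥0∞) (V : Fin n → Submodule ℝ E),
    (∀ j, 0 < p j) → ∃ κ N : ℝ, 0 < κ ∧ 0 ≤ N ∧
      ∀ (a : ∀ j, V j) (ε : ℝ), 0 < ε → ∀ (T : ℝ≥0∞) (G : (∀ j, V j) → ℝ≥0∞),
        (∀ x, (∀ j, ‖x j - a j‖ < ε) → T ≤ G x) →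
          T * ENNReal.ofReal (κ * ε ^ N) ≤ iteratedLpNorm n p V G
  | 0, p, V, _ => ⟨1, 0, one_pos, le_rfl, fun a ε hε T G h => by
      simpa [iteratedLpNorm] using h (fun j => j.elim0) fun j => j.elim0⟩
  | n + 1, p, V, hp => by
    obtain ⟨κ, N, hκ, hN, ih⟩ := exists_le_iteratedLpNorm n (fun j => p j.succ)
      (fun j => V j.succ) fun j => hp j.succ
    obtain ⟨κ', N', hκ', hN', hball⟩ :=
      exists_le_addHaar_ball_rpow (volume : Measure (V 0)) (p 0)
    refine ⟨κ' * κ, N' + N, by positivity, by positivity, fun a ε hε T G h => ?_⟩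
    rw [iteratedLpNorm]
    refine le_trans ?_ (ih (fun j => a j.succ) ε hε (T * ENNReal.ofReal (κ' * ε ^ N')) _
      fun y hy => ?_)
    · rw [mul_assoc T, ← ENNReal.ofReal_mul (by positivity), Real.rpow_add hε]
      refine mul_le_mul_right (ENNReal.ofReal_le_ofReal (le_of_eq ?_)) T
      ring
    · refine (mul_le_mul_right (hball (a 0) ε hε) T).trans
        (mul_measure_rpow_le_eLpNorm (hp 0).ne' Metric.isOpen_ball.measurableSet
          (Metric.measure_ball_pos _ _ hε).ne' fun x hx => ?_)
      rw [enorm_eq_self]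
      refine h _ fun j => ?_
      refine Fin.cases ?_ (fun i => ?_) j
      · rw [Metric.mem_ball, dist_eq_norm] at hx
        simpa using hx
      · simpa using hy i

/-- The majorant is a product over the factors, so each integration only multiplies the constant D
by a finite norm. -/
theorem iteratedLpNorm_lt_top {c : ℝ} (hc : 0 < c) : ∀ (n : ℕ) (p : Fin n → ℝ≥0∞)
    (V : Fin n → Submodule ℝ E) (D : ℝ) (G : (∀ j, V j) → ℝ≥0∞), 0 ≤ D →
    (∀ x, G x ≤ ENNReal.ofReal (D * Real.exp (-c * ∑ j, ‖x j‖))) → iteratedLpNorm n p V G < ∞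
  | 0, p, V, D, G, _, h => (h _).trans_lt ENNReal.ofReal_lt_top
  | n + 1, p, V, D, G, hD, h => by
    have hfin := eLpNorm_exp_neg_mul_norm_lt_top (volume : Measure (V 0)) hc (p 0)
    set M := eLpNorm (fun x : V 0 => Real.exp (-c * ‖x‖)) (p 0) volume with hM
    rw [iteratedLpNorm]
    refine iteratedLpNorm_lt_top hc n _ _ (D * M.toReal) _ (by positivity) fun y => ?_
    set k := D * Real.exp (-c * ∑ j, ‖y j‖) with hk
    have hk0 : 0 ≤ k := by positivity
    have h1 : eLpNorm (fun x : V 0 => G (Fin.cons (α := fun j => V j) x y)) (p 0) volume ≤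
        eLpNorm (k • fun x : V 0 => Real.exp (-c * ‖x‖)) (p 0) volume := by
      refine eLpNorm_mono_enorm fun x => ?_
      rw [enorm_eq_self, Pi.smul_apply, smul_eq_mul, Real.enorm_of_nonneg (by positivity)]
      refine (h _).trans (ENNReal.ofReal_le_ofReal (le_of_eq ?_))
      rw [Fin.sum_univ_succ, mul_add, Real.exp_add]
      simp only [Fin.cons_zero, Fin.cons_succ, hk]
      ring
    refine (h1.trans eLpNorm_const_smul_le).trans (le_of_eq ?_)
    rw [Real.enorm_of_nonneg hk0, ← hM, ← ENNReal.ofReal_toReal hfin.ne,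
      ← ENNReal.ofReal_mul hk0, ENNReal.toReal_ofReal ENNReal.toReal_nonneg, hk]
    ring_nf

end IteratedNorm

/-! ### Equivalence of the quasi-norm conditions with exponential type. -/

theorem exists_directSum_coordinates {E : Type*} [NormedAddCommGroup E] [InnerProductSpace ℝ E]
    {n : ℕ} {V : Fin n → Submodule ℝ E}
    (hV : DirectSum.IsInternal V) :
    ∃ P : ∀ j, E →ₗ[ℝ] V j, (∀ X, ∑ j, (P j X : E) = X) ∧
      ∀ (x : ∀ j, V j) (j), P j (∑ i, (x i : E)) = x j := by
  let S : (∀ j, V j) →ₗ[ℝ] E := ∑ j, (V j).subtype ∘ₗ LinearMap.proj j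
  have hS : ∀ x, S x = ∑ j, (x j : E) := fun x => by simp [S]
  have hcomp : ⇑(DirectSum.coeLinearMap V) =
      S ∘ DirectSum.linearEquivFunOnFintype ℝ (Fin n) fun j => V j := by
    have : DirectSum.coeLinearMap V =
        S ∘ₗ (DirectSum.linearEquivFunOnFintype ℝ (Fin n) fun j => V j).toLinearMap := by
      refine DirectSum.linearMap_ext _ fun i => LinearMap.ext fun x => ?_
      have h : ∑ j, ((Pi.single i x : ∀ j, V j) j : E) = (x : E) := by
        rw [Finset.sum_eq_single i (fun j _ hj => by rw [Pi.single_eq_of_ne hj]; rfl) (by simp),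
          Pi.single_eq_same]
      simp [hS, DirectSum.linearEquivFunOnFintype_lof, h]
    exact congrArg _ this
  have hbij : Function.Bijective S := by
    have h : Function.Bijective (DirectSum.coeLinearMap V) := hV
    rw [hcomp] at h
    exact (Function.Bijective.of_comp_iff _ (LinearEquiv.bijective _)).1 h
  let e := LinearEquiv.ofBijective S hbij
  refine ⟨fun j => LinearMap.proj j ∘ₗ e.symm.toLinearMap, fun X => ?_, fun x j => ?_⟩
  · rw [← hS]
    exact e.apply_symm_apply X
  · rw [← hS]
    exact congrFun (e.symm_apply_apply x) j

theorem hermiteSeries_mem_HFlat_of_eLpNorm_lt_top {d : ℕ} {f : PilipovicDistribution d}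
    {p : ℝ≥0∞} (hp : 0 < p) {R : ℝ} (hR : 0 < R)
    (h : eLpNorm (fun z : CSpace d =>
      bargmannTransform (hermiteSeries f) z * (Real.exp (-R * ‖z‖) : ℂ)) p volume < ∞) :
    hermiteSeries f ∈ HFlat d := by
  obtain ⟨κ, N, hκ, hN, hball⟩ := exists_le_addHaar_ball_rpow (volume : Measure (CSpace d)) p
  set Q := eLpNorm (fun z : CSpace d =>
      bargmannTransform (hermiteSeries f) z * (Real.exp (-R * ‖z‖) : ℂ)) p volume with hQ
  refine hermiteSeries_mem_HFlat_of_small_ball_estimate (K := Q.toReal * Real.exp R / κ) (R := R)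
    (N := N) hR.le hN fun z ε t hε hε1 ht hw => ?_
  have h1 : ENNReal.ofReal (t * Real.exp (-R * (‖z‖ + 1))) * ENNReal.ofReal (κ * ε ^ N) ≤ Q := by
    refine (mul_le_mul_right (hball z ε hε) _).trans
      (mul_measure_rpow_le_eLpNorm hp.ne' Metric.isOpen_ball.measurableSet
        (Metric.measure_ball_pos _ _ hε).ne' fun w hwz => ?_)
    rw [Metric.mem_ball, dist_eq_norm] at hwz
    rw [← ofReal_norm, norm_mul, Complex.norm_real, Real.norm_of_nonneg (Real.exp_pos _).le]
    refine ENNReal.ofReal_le_ofReal (mul_le_mul (hw w hwz) (Real.exp_le_exp.2 ?_)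
      (Real.exp_pos _).le (norm_nonneg _))
    have : ‖w‖ ≤ ‖z‖ + 1 := by linarith [norm_sub_norm_le w z]
    nlinarith
  rw [← ENNReal.ofReal_mul (by positivity), ENNReal.ofReal_le_iff_le_toReal h.ne] at h1
  rw [div_mul_eq_mul_div, le_div_iff₀ hκ]
  calc t * ε ^ N * κ = t * Real.exp (-R * (‖z‖ + 1)) * (κ * ε ^ N) *
        (Real.exp R * Real.exp (R * ‖z‖)) := by
        rw [← Real.exp_add, show R + R * ‖z‖ = -(-R * (‖z‖ + 1)) by ring, Real.exp_neg]
        field_simp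
    _ ≤ Q.toReal * (Real.exp R * Real.exp (R * ‖z‖)) := by gcongr
    _ = _ := by ring

theorem eLpNorm_lt_top_of_mem_AFlat {d : ℕ} {F : CSpace d → ℂ} (hF : F ∈ AFlat d) (p : ℝ≥0∞) :
    ∃ R : ℝ, 0 < R ∧
      eLpNorm (fun z : CSpace d => F z * (Real.exp (-R * ‖z‖) : ℂ)) p volume < ∞ := by
  obtain ⟨-, r, hr, C, hC⟩ := hF
  have hC0 : 0 ≤ C := nonneg_of_mul_nonneg_left ((norm_nonneg _).trans (hC 0)) (Real.exp_pos _)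
  refine ⟨r + 1, by positivity, ?_⟩
  have hfin := eLpNorm_exp_neg_mul_norm_lt_top (volume : Measure (CSpace d)) one_pos p
  refine lt_of_le_of_lt ?_ (ENNReal.mul_lt_top (enorm_lt_top (x := C)) hfin)
  refine le_trans ?_ (eLpNorm_const_smul_le (c := C))
  refine eLpNorm_mono_real fun z => ?_
  rw [norm_mul, Complex.norm_real, Real.norm_of_nonneg (Real.exp_pos _).le, Pi.smul_apply,
    smul_eq_mul]
  calc ‖F z‖ * Real.exp (-(r + 1) * ‖z‖)
      ≤ C * Real.exp (r * ‖z‖) * Real.exp (-(r + 1) * ‖z‖) := by gcongr; exact hC z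
    _ = _ := by
      rw [mul_assoc, ← Real.exp_add]
      ring_nf

theorem norm_phaseToComplex_pos_freq {d : ℕ} (X : PhaseSpace d) :
    ‖X‖ ^ 2 = 2 * ‖phaseToComplex X.pos X.freq‖ ^ 2 := by
  rw [norm_phaseToComplex_sq, norm_phaseSpace_sq]
  ring

theorem norm_phaseToComplex_le {d : ℕ} (X : PhaseSpace d) :
    ‖phaseToComplex X.pos X.freq‖ ≤ ‖X‖ := by
  refine (sq_le_sq₀ (norm_nonneg _) (norm_nonneg _)).1 ?_
  rw [norm_phaseToComplex_pos_freq X]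
  nlinarith [sq_nonneg ‖phaseToComplex X.pos X.freq‖]

theorem norm_le_two_mul_norm_phaseToComplex {d : ℕ} (X : PhaseSpace d) :
    ‖X‖ ≤ 2 * ‖phaseToComplex X.pos X.freq‖ := by
  refine (sq_le_sq₀ (norm_nonneg _) (by positivity)).1 ?_
  rw [norm_phaseToComplex_pos_freq X]
  nlinarith [sq_nonneg ‖phaseToComplex X.pos X.freq‖]

theorem phaseToComplex_sub {d : ℕ} (X Y : PhaseSpace d) :
    phaseToComplex (X - Y).pos (X - Y).freq =
      phaseToComplex X.pos X.freq - phaseToComplex Y.pos Y.freq := by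
  ext j
  simp only [phaseToComplex, PhaseSpace.pos, PhaseSpace.freq, PiLp.sub_apply]
  push_cast
  ring

theorem exists_phaseToComplex_eq {d : ℕ} (z : CSpace d) :
    ∃ X : PhaseSpace d, phaseToComplex X.pos X.freq = z := by
  refine ⟨WithLp.toLp 2 (Sum.elim (fun j => √2 * (z j).re) fun j => -(√2 * (z j).im)), ?_⟩
  have h2 : ((√2 : ℝ) : ℂ) ≠ 0 := by exact_mod_cast (by positivity : √(2 : ℝ) ≠ 0)
  ext j
  simp only [phaseToComplex, PhaseSpace.pos, PhaseSpace.freq, Sum.elim_inl, Sum.elim_inr]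
  rw [div_eq_iff h2]
  conv_rhs => rw [← Complex.re_add_im (z j)]
  push_cast
  ring

theorem norm_le_norm_pos_add_norm_freq {d : ℕ} (X : PhaseSpace d) :
    ‖X‖ ≤ ‖X.pos‖ + ‖X.freq‖ := by
  refine (sq_le_sq₀ (norm_nonneg _) (by positivity)).1 ?_
  rw [norm_phaseSpace_sq]
  nlinarith [mul_nonneg (norm_nonneg X.pos) (norm_nonneg X.freq)]

theorem norm_pos_add_norm_freq_le {d : ℕ} (X : PhaseSpace d) :
    ‖X.pos‖ + ‖X.freq‖ ≤ 2 * ‖X‖ := by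
  refine (sq_le_sq₀ (by positivity) (by positivity)).1 ?_
  rw [mul_pow, norm_phaseSpace_sq]
  nlinarith [sq_nonneg (‖X.pos‖ - ‖X.freq‖), sq_nonneg ‖X.pos‖, sq_nonneg ‖X.freq‖]

theorem hermiteSeries_mem_HFlat_of_mem_modulationSpace {d : ℕ} {f : PilipovicDistribution d}
    (𝓑 : MixedQuasiNormSpace (PhaseSpace d)) {R : ℝ} (hR : 0 < R)
    (h : f ∈ modulationSpace (weightOmega R) 𝓑) : hermiteSeries f ∈ HFlat d := by
  obtain ⟨κ, N, hκ, hN, hlow⟩ := exists_le_iteratedLpNorm 𝓑.n 𝓑.p 𝓑.V 𝓑.p_pos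
  obtain ⟨P, hP, -⟩ := exists_directSum_coordinates 𝓑.isInternal
  set Q := 𝓑.quasiNorm (fun X => stft f X.pos X.freq * (weightOmega R X : ℂ)) with hQ
  have hQfin : Q < ∞ := h
  set k : ℝ := (2 * Real.pi) ^ (-(d : ℝ) / 2) with hk
  have hk0 : 0 < k := by
    have := Real.pi_pos
    positivity
  set q : ℝ := (𝓑.n + 1 : ℝ) ^ N with hq
  have hq0 : 0 < q := by positivity
  refine hermiteSeries_mem_HFlat_of_small_ball_estimate
    (K := Q.toReal * Real.exp (2 * R) * q / (κ * k)) (R := 4 * R)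
    (N := N) (by positivity) hN fun z ε t hε hε1 ht hw => ?_
  obtain ⟨X₀, rfl⟩ := exists_phaseToComplex_eq z
  -- A box of side ε/(n+1) in the coordinates of V_1 ⊕ ⋯ ⊕ V_n lies in the ε-ball about X₀; n + 1
  -- gives strict inequality and admits n = 0. The exponent in the level uses |x| + |ξ| ≤ 2|X| and
  -- |X| ≤ |X₀| + 1.
  have h1 := hlow (fun j => P j X₀) (ε / (𝓑.n + 1)) (by positivity)
    (ENNReal.ofReal (k * (t * Real.exp (-R * (2 * (‖X₀‖ + 1))))))
    (fun x => ‖stft f (PhaseSpace.pos (∑ j, (x j : PhaseSpace d)))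
        (PhaseSpace.freq (∑ j, (x j : PhaseSpace d)))
      * (weightOmega R (∑ j, (x j : PhaseSpace d)) : ℂ)‖ₑ) fun x hx => by
      set X : PhaseSpace d := ∑ j, (x j : PhaseSpace d) with hX
      have hXX : ‖X - X₀‖ < ε := by
        rw [← hP X₀, hX, ← Finset.sum_sub_distrib]
        calc ‖∑ j, ((x j : PhaseSpace d) - (P j X₀ : PhaseSpace d))‖
            ≤ ∑ j : Fin 𝓑.n, ε / (𝓑.n + 1) :=
              norm_sum_le_of_le _ fun j _ => (hx j).le
          _ = ε * (𝓑.n / (𝓑.n + 1)) := by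
              rw [Finset.sum_const, Finset.card_univ, Fintype.card_fin, nsmul_eq_mul]
              ring
          _ < ε * 1 := by
              gcongr
              rw [div_lt_one (by positivity)]
              linarith
          _ = ε := mul_one ε
      rw [← ofReal_norm, norm_stft_mul_weightOmega]
      refine ENNReal.ofReal_le_ofReal (mul_le_mul_of_nonneg_left (mul_le_mul
        (hw _ ?_) (Real.exp_le_exp.2 ?_) (Real.exp_pos _).le (norm_nonneg _)) hk0.le)
      · rw [← phaseToComplex_sub]
        exact (norm_phaseToComplex_le _).trans_lt hXX
      · have h2 : ‖X‖ ≤ ‖X₀‖ + 1 := by linarith [norm_sub_norm_le X X₀]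
        have h3 := norm_pos_add_norm_freq_le X
        nlinarith
  change _ ≤ Q at h1
  rw [← ENNReal.ofReal_mul (by positivity), ENNReal.ofReal_le_iff_le_toReal hQfin.ne,
    Real.div_rpow hε.le (by positivity), ← hq] at h1
  have h4 := norm_le_two_mul_norm_phaseToComplex X₀
  rw [div_mul_eq_mul_div, le_div_iff₀ (by positivity)]
  calc t * ε ^ N * (κ * k) = k * (t * Real.exp (-R * (2 * (‖X₀‖ + 1)))) * (κ * (ε ^ N / q)) *
        (q * Real.exp (R * (2 * (‖X₀‖ + 1)))) := by
        rw [neg_mul, Real.exp_neg]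
        field_simp
    _ ≤ Q.toReal * (q * Real.exp (2 * R + 4 * R * ‖phaseToComplex X₀.pos X₀.freq‖)) := by
        gcongr
        nlinarith
    _ = _ := by
        rw [Real.exp_add]
        ring

theorem mem_modulationSpace_of_mem_AFlat {d : ℕ} {f : PilipovicDistribution d}
    (hF : bargmannTransform (hermiteSeries f) ∈ AFlat d)
    (𝓑 : MixedQuasiNormSpace (PhaseSpace d)) :
    ∃ R : ℝ, 0 < R ∧ f ∈ modulationSpace (weightOmega R) 𝓑 := by
  obtain ⟨-, r, hr, C, hC⟩ := hF
  have hC0 : 0 ≤ C := nonneg_of_mul_nonneg_left ((norm_nonneg _).trans (hC 0)) (Real.exp_pos _)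
  obtain ⟨P, -, hP⟩ := exists_directSum_coordinates 𝓑.isInternal
  set B : ℝ := ∑ j, ‖(P j).toContinuousLinearMap‖ + 1 with hB
  have hB0 : 0 < B := by positivity
  -- The subspaces need not be orthogonal; continuity of the coordinate projections replaces
  -- orthogonality.
  have hcoord : ∀ x : ∀ j, 𝓑.V j, ∑ j, ‖x j‖ ≤ B * ‖∑ j, (x j : PhaseSpace d)‖ := fun x => by
    have h1 : ∀ j, ‖x j‖ ≤ ‖(P j).toContinuousLinearMap‖ * ‖∑ j, (x j : PhaseSpace d)‖ :=
      fun j => by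
        conv_lhs => rw [← hP x j]
        exact (P j).toContinuousLinearMap.le_opNorm _
    calc _ ≤ ∑ j, ‖(P j).toContinuousLinearMap‖ * ‖∑ j, (x j : PhaseSpace d)‖ :=
          Finset.sum_le_sum fun j _ => h1 j
      _ = (∑ j, ‖(P j).toContinuousLinearMap‖) * ‖∑ j, (x j : PhaseSpace d)‖ := by
          rw [Finset.sum_mul]
      _ ≤ _ := by
          gcongr
          linarith
  set k : ℝ := (2 * Real.pi) ^ (-(d : ℝ) / 2) with hk
  have hk0 : 0 < k := by
    have := Real.pi_pos
    positivity
  -- The extra 1 leaves a factor e^{-|X|}, which decays exponentially in every coordinate of the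
  -- direct sum.
  refine ⟨r + 1, by positivity, ?_⟩
  refine iteratedLpNorm_lt_top (c := 1 / B) (by positivity) _ _ _ (k * C) _ (by positivity)
    fun x => ?_
  set X : PhaseSpace d := ∑ j, (x j : PhaseSpace d) with hX
  rw [← ofReal_norm, norm_stft_mul_weightOmega, mul_assoc]
  refine ENNReal.ofReal_le_ofReal (mul_le_mul_of_nonneg_left ?_ hk0.le)
  have h1 : 1 / B * ∑ j, ‖x j‖ ≤ ‖X‖ := by
    rw [one_div, inv_mul_le_iff₀ hB0]
    exact hcoord x
  have h2 := norm_le_norm_pos_add_norm_freq X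
  have h3 := norm_phaseToComplex_le X
  calc _ ≤ C * Real.exp (r * ‖phaseToComplex X.pos X.freq‖) *
        Real.exp (-(r + 1) * (‖X.pos‖ + ‖X.freq‖)) := by gcongr; exact hC _
    _ = C * Real.exp (r * ‖phaseToComplex X.pos X.freq‖ +
        -(r + 1) * (‖X.pos‖ + ‖X.freq‖)) := by rw [mul_assoc, Real.exp_add]
    _ ≤ C * Real.exp (-(1 / B) * ∑ j, ‖x j‖) := by
        gcongr
        nlinarith

theorem mainTheorem2 (d : ℕ) :
    -- the Hermite functions and the shifted windows are test functions, so that the Hermite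
    -- coefficients and the short-time Fourier transform of `f ∈ 𝚺'` are what they should be
    (∀ α : Fin d → ℕ, hermiteFunction α ∈ pilipovicFunctions d) ∧
    (∀ x ξ : RSpace d, stftAtom x ξ ∈ pilipovicFunctions d) ∧
    -- the power series defining the Bargmann transform converges for `f ∈ 𝚺'`
    (∀ (f : PilipovicDistribution d) (z : CSpace d),
      Summable fun α => hermiteSeries f α * monomialE α z) ∧
    -- the equivalence of the three conditions
    (∀ (p : ℝ≥0∞), 0 < p → ∀ (𝓑 : MixedQuasiNormSpace (PhaseSpace d))
      (f : PilipovicDistribution d),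
      List.TFAE
        [hermiteSeries f ∈ HFlat d,
         ∃ R : ℝ, 0 < R ∧ eLpNorm (fun z : CSpace d =>
            bargmannTransform (hermiteSeries f) z * (Real.exp (-R * ‖z‖) : ℂ)) p volume < ∞,
         ∃ R : ℝ, 0 < R ∧ f ∈ modulationSpace (weightOmega R) 𝓑]) ∧
    -- the Bargmann transform on `𝓗_♭`
    (∀ c ∈ HFlat d, ∀ z : CSpace d, Summable fun α => c α * monomialE α z) ∧
    Set.BijOn (bargmannTransform (d := d)) (HFlat d) (AFlat d) := by
  refine ⟨hermiteFunction_mem_pilipovicFunctions, stftAtom_mem_pilipovicFunctions,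
    summable_hermiteSeries_mul_monomialE, fun p hp 𝓑 f => ?_, ?_, bijOn_bargmannTransform d⟩
  · tfae_have 1 → 2 := fun h => eLpNorm_lt_top_of_mem_AFlat (bargmannTransform_mem_AFlat h) p
    tfae_have 2 → 1 := fun ⟨R, hR, h⟩ => hermiteSeries_mem_HFlat_of_eLpNorm_lt_top hp hR h
    tfae_have 1 → 3 := fun h => mem_modulationSpace_of_mem_AFlat (bargmannTransform_mem_AFlat h) 𝓑
    tfae_have 3 → 1 := fun ⟨R, hR, h⟩ => hermiteSeries_mem_HFlat_of_mem_modulationSpace 𝓑 hR h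
    tfae_finish
  · rintro c ⟨R, hR, C, hC⟩ z
    exact (summable_norm_mul_monomialE (norm_le_of_mem_HFlat_bound hR hC) z).of_norm
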